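/- Let $M$ be a connected smooth manifold and $\omega$ a 2-plectic form on $M$, i.e. a closed 3-form such that $v\mapsto \iota_v\omega$ is injective on each $T_xM$. A 1-form $\alpha$ is Hamiltonian if $d\alpha=-\iota_{v_\alpha}\omega$ for a (necessarily unique) vector field $v_\alpha$; such $v_\alpha$ are called Hamiltonian vector fields. Let $L_\infty(M,\omega)$ be the Lie 2-algebra with $\Omega^1_{\mathrm{Ham}}(M)$ in degree $0$ and $C^\infty(M)$ in degree $-1$, unary bracket the de Rham differential $d:C^\infty(M)\to\Omega^1_{\mathrm{Ham}}(M)$, binary bracket $[\alpha,\beta]'=\omega(v_\alpha,v_\beta,\cdot)$ on $\Omega^1_{\mathrm{Ham}}(M)$, trinary bracket $[\alpha,\beta,\gamma]'=-\omega(v_\alpha,v_\beta,v_\gamma)$, and all other brackets zero. Let $v:\mathfrak g\to\mathfrak X(M)$, $x\mapsto v_x$, be a morphism from a real Lie algebra $\mathfrak g$, with values in Hamiltonian vector fields. Let $L=\mathfrak h[1]\oplus\mathfrak g$ be a minimal Lie 2-algebra (unary bracket zero) whose binary bracket on $\mathfrak g$ is the Lie bracket. For a Lie 2-algebra with degree-zero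 part $\mathfrak g$, a moment map is an $L_\infty$-morphism $\phi=(\phi_1,\phi_2)$ from it to $L_\infty(M,\omega)$ such that $d(\phi_1(x))=-\iota_{v_x}\omega$ for all $x\in\mathfrak g$. Fix $p\in M$, put $\omega_{3p}(x,y,z)=\omega(v_x,v_y,v_z)|_p$, and let $\mathbb R[1]\oplus_{-\omega_{3p}}\mathfrak g$ carry the Lie bracket of $\mathfrak g$, the trinary bracket $-\omega_{3p}$ on $\mathfrak g$, and zero as every other bracket. Let $CE(L)=\big(S^{\ge1}(\mathfrak h[2]\oplus\mathfrak g[1])\big)^*$ be the Chevalley–Eilenberg complex of $L$, with differential $d_{CE(L)}=d_1-d_2+d_3$, where $d_i$ is precomposition with the coderivation extending $l_i$, and where $l_1=0$ (by minimality), $l_2(x,y)=[x,y]$, $l_2(x,h)=l_2(h,x)=[x,h]$, $l_3(x,y,z)=-[x,y,z]$ for $x,y,z\in\mathfrak g$, $h\in\mathfrak h$; $\omega_{3p}$ is regarded as an element of $CE(L)^3$. Fix a linear map $\gamma_1:\mathfrak g\to\Omega^1_{\mathrm{Ham}}(M)$ with $d(\gamma_1(x))=-\iota_{v_x}\omega$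 for all $x$. Assume $H^1(M)=0$. Then $\mathbb R[1]\oplus_{-\omega_{3p}}\mathfrak g$ is a Lie 2-algebra, and it has a moment map $\gamma=(\gamma_1,\gamma_2)$, where $\gamma_1$ is as above on $\mathfrak g$ and sends $r\in\mathbb R$ to the constant function $r$, and where $\gamma_2(x,y)$ is the unique $f\in C^\infty(M)$ with $$df=\gamma_1([x,y])-\omega(v_x,v_y,\cdot),\qquad f(p)=0 .$$ Moreover, for every $\eta\in CE(L)^2=\mathfrak h[2]^*\oplus S^2(\mathfrak g[1])^*$ with $d_{CE(L)}\eta=\omega_{3p}$, the maps $f_1=(\eta|_{\mathfrak h},\mathrm{id}_{\mathfrak g})$ and $f_2=\eta|_{S^2(\mathfrak g[1])}$ form an $L_\infty$-morphism $f:L\to\mathbb R[1]\oplus_{-\omega_{3p}}\mathfrak g$, and $\phi^\eta:=\gamma\circ f$ is a moment map for $L$. Explicitly, for $x,y\in\mathfrak g$ and $h\in\mathfrak h$, $$\phi^\eta_1(x)=\gamma_1(x),\qquad \phi^\eta_1(h)=\eta(h),\qquad \phi^\eta_2(x,y)=\eta(x,y)+\gamma_2(x,y),$$ where the real numbers $\eta(h)$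 and $\eta(x,y)$ are viewed as constant functions on $M$. -/

import Mathlib

open scoped Manifold ContDiff Topology

noncomputable section

set_option linter.unusedSectionVars false

namespace MomentMap

section Local
variable {E : Type*} [NormedAddCommGroup E] [NormedSpace ℝ E]

theorem fderiv_three {w : E → E [⋀^Fin 3]→L[ℝ] ℝ} {f g h : E → E} {x : E}
    (hw : DifferentiableAt ℝ w x) (hf : DifferentiableAt ℝ f x) (hg : DifferentiableAt ℝ g x)
    (hh : DifferentiableAt ℝ h x) (e : E) :
    fderiv ℝ (fun y => w y ![f y, g y, h y]) x e = fderiv ℝ w x e ![f x, g x, h x] +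
      w x ![fderiv ℝ f x e, g x, h x] + w x ![f x, fderiv ℝ g x e, h x] +
      w x ![f x, g x, fderiv ℝ h x e] := by
  have h1 := fderiv_continuousAlternatingMap_apply_apply (f := w) (g := ![f, g, h]) (x := x) hw
    (by intro i; fin_cases i <;> assumption) e
  have h2 : ∀ y, (fun i => (![f, g, h] : Fin 3 → E → E) i y) = ![f y, g y, h y] := by
    intro y; funext i; fin_cases i <;> rfl
  simp only [h2] at h1
  rw [h1, Fin.sum_univ_three, ← add_assoc, ← add_assoc]
  congr 1
  · congr 1
    · congr 2
      funext i; fin_cases i <;> simp [Function.update]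
    · congr 1
      funext i; fin_cases i <;> simp [Function.update]
  · congr 1
    funext i; fin_cases i <;> simp [Function.update]

theorem swap12 (a : E [⋀^Fin 3]→L[ℝ] ℝ) (p q r : E) : a ![q, p, r] = - a ![p, q, r] := by
  have := a.toAlternatingMap.map_swap ![p, q, r] (show (0 : Fin 3) ≠ 1 by decide)
  have e : ![p, q, r] ∘ Equiv.swap (0 : Fin 3) 1 = ![q, p, r] := by
    funext i; fin_cases i <;> rfl
  rw [e] at this
  exact this

theorem swap23 (a : E [⋀^Fin 3]→L[ℝ] ℝ) (p q r : E) : a ![p, r, q] = - a ![p, q, r] := by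
  have := a.toAlternatingMap.map_swap ![p, q, r] (show (1 : Fin 3) ≠ 2 by decide)
  have e : ![p, q, r] ∘ Equiv.swap (1 : Fin 3) 2 = ![p, r, q] := by
    funext i; fin_cases i <;> rfl
  rw [e] at this
  exact this

theorem extDeriv_three (w : E → E [⋀^Fin 3]→L[ℝ] ℝ) (x a b c d : E) :
    extDeriv w x ![a, b, c, d] = fderiv ℝ w x a ![b, c, d] - fderiv ℝ w x b ![a, c, d] +
      fderiv ℝ w x c ![a, b, d] - fderiv ℝ w x d ![a, b, c] := by
  have h0 : (0 : Fin 4).removeNth ![a, b, c, d] = ![b, c, d] := by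
    funext i; fin_cases i <;> rfl
  have h1 : (1 : Fin 4).removeNth ![a, b, c, d] = ![a, c, d] := by
    funext i; fin_cases i <;> rfl
  have h2 : (2 : Fin 4).removeNth ![a, b, c, d] = ![a, b, d] := by
    funext i; fin_cases i <;> rfl
  have h3 : (3 : Fin 4).removeNth ![a, b, c, d] = ![a, b, c] := by
    funext i; fin_cases i <;> rfl
  rw [extDeriv, ContinuousAlternatingMap.alternatizeUncurryFin_apply, Fin.sum_univ_four,
    h0, h1, h2, h3]
  simp
  ring

theorem contDiff_curryLeft (k : ℕ) :
    ContDiff ℝ ∞ fun a : E [⋀^Fin (k + 1)]→L[ℝ] ℝ => a.curryLeft := by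
  apply IsBoundedLinearMap.contDiff
  exact ⟨⟨fun _ _ => rfl, fun _ _ => rfl⟩, 1, one_pos, fun a => by simp⟩

theorem differentiableAt_curryLeft {k : ℕ} {w : E → E [⋀^Fin (k + 1)]→L[ℝ] ℝ} {X : E → E} {x : E}
    (hw : DifferentiableAt ℝ w x) (hX : DifferentiableAt ℝ X x) :
    DifferentiableAt ℝ (fun y => (w y).curryLeft (X y)) x := by
  have h : DifferentiableAt ℝ (fun y => (w y).curryLeft) x :=
    ((contDiff_curryLeft k).differentiable (by simp)).differentiableAt.comp x hw
  exact h.clm_apply hX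

theorem contDiffAt_curryLeft {k : ℕ} {w : E → E [⋀^Fin (k + 1)]→L[ℝ] ℝ} {X : E → E} {x : E}
    (hw : ContDiffAt ℝ ∞ w x) (hX : ContDiffAt ℝ ∞ X x) :
    ContDiffAt ℝ ∞ (fun y => (w y).curryLeft (X y)) x := by
  have h : ContDiffAt ℝ ∞ (fun y => (w y).curryLeft) x :=
    (contDiff_curryLeft k).contDiffAt.comp x hw
  exact h.clm_apply hX

theorem extDeriv_curry_one {w : E → E [⋀^Fin 3]→L[ℝ] ℝ} {X : E → E} {x : E}
    (hw : DifferentiableAt ℝ w x) (hX : DifferentiableAt ℝ X x) (a b c : E) :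
    extDeriv (fun y => (w y).curryLeft (X y)) x ![a, b, c] =
      (fderiv ℝ w x a ![X x, b, c] + w x ![fderiv ℝ X x a, b, c])
      - (fderiv ℝ w x b ![X x, a, c] + w x ![fderiv ℝ X x b, a, c])
      + (fderiv ℝ w x c ![X x, a, b] + w x ![fderiv ℝ X x c, a, b]) := by
  have h0 : (0 : Fin 3).removeNth ![a, b, c] = ![b, c] := by
    funext i; fin_cases i <;> rfl
  have h1 : (1 : Fin 3).removeNth ![a, b, c] = ![a, c] := by
    funext i; fin_cases i <;> rfl
  have h2 : (2 : Fin 3).removeNth ![a, b, c] = ![a, b] := by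
    funext i; fin_cases i <;> rfl
  have key : ∀ p q e : E, fderiv ℝ (fun y => w y ![X y, p, q]) x e =
      fderiv ℝ w x e ![X x, p, q] + w x ![fderiv ℝ X x e, p, q] := by
    intro p q e
    have := fderiv_three hw hX (differentiableAt_const p) (differentiableAt_const q) e
    simp only [fderiv_const_apply, zero_apply] at this
    rw [this, (w x).map_coord_zero (m := ![X x, 0, q]) 1 rfl,
      (w x).map_coord_zero (m := ![X x, p, 0]) 2 rfl, add_zero, add_zero]
  rw [extDeriv_apply (differentiableAt_curryLeft hw hX), Fin.sum_univ_three, h0, h1, h2]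
  have e : ∀ p q : E, (fun y => (w y).curryLeft (X y) ![p, q]) = fun y => w y ![X y, p, q] :=
    fun p q => rfl
  simp only [e, key]
  simp
  ring

theorem extDeriv_curry_two {w : E → E [⋀^Fin 3]→L[ℝ] ℝ} {X Y : E → E} {x : E}
    (hw : DifferentiableAt ℝ w x) (hX : DifferentiableAt ℝ X x) (hY : DifferentiableAt ℝ Y x)
    (a b : E) :
    extDeriv (fun y => ((w y).curryLeft (X y)).curryLeft (Y y)) x ![a, b] =
      (fderiv ℝ w x a ![X x, Y x, b] + w x ![fderiv ℝ X x a, Y x, b]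
        + w x ![X x, fderiv ℝ Y x a, b])
      - (fderiv ℝ w x b ![X x, Y x, a] + w x ![fderiv ℝ X x b, Y x, a]
        + w x ![X x, fderiv ℝ Y x b, a]) := by
  have h0 : (0 : Fin 2).removeNth ![a, b] = ![b] := by
    funext i; fin_cases i; rfl
  have h1 : (1 : Fin 2).removeNth ![a, b] = ![a] := by
    funext i; fin_cases i; rfl
  have key : ∀ q e : E, fderiv ℝ (fun y => w y ![X y, Y y, q]) x e =
      fderiv ℝ w x e ![X x, Y x, q] + w x ![fderiv ℝ X x e, Y x, q]
        + w x ![X x, fderiv ℝ Y x e, q] := by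
    intro q e
    have := fderiv_three hw hX hY (differentiableAt_const q) e
    simp only [fderiv_const_apply, zero_apply] at this
    rw [this, (w x).map_coord_zero (m := ![X x, Y x, 0]) 2 rfl, add_zero]
  rw [extDeriv_apply (differentiableAt_curryLeft (differentiableAt_curryLeft hw hX) hY),
    Fin.sum_univ_two, h0, h1]
  have e : ∀ q : E, (fun y => ((w y).curryLeft (X y)).curryLeft (Y y) ![q]) =
      fun y => w y ![X y, Y y, q] := fun q => rfl
  simp only [e, key]
  simp
  ring

/-- Cartan calculus: `d (ι_Y ι_X w) = - ι_[X,Y] w` if `w`, `ι_X w`, `ι_Y w` are closed. -/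
theorem extDeriv_bracket {w : E → E [⋀^Fin 3]→L[ℝ] ℝ} {X Y : E → E} {x : E}
    (hw : DifferentiableAt ℝ w x) (hX : DifferentiableAt ℝ X x) (hY : DifferentiableAt ℝ Y x)
    (h : extDeriv w x = 0) (h1 : extDeriv (fun y => (w y).curryLeft (X y)) x = 0)
    (h2 : extDeriv (fun y => (w y).curryLeft (Y y)) x = 0) :
    extDeriv (fun y => ((w y).curryLeft (X y)).curryLeft (Y y)) x =
      -(w x).curryLeft (VectorField.lieBracket ℝ X Y x) := by
  ext v
  obtain ⟨a, b, rfl⟩ : ∃ a b, v = ![a, b] := ⟨v 0, v 1, by funext i; fin_cases i <;> rfl⟩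
  have e0 := extDeriv_three w x (X x) (Y x) a b
  have e1 := extDeriv_curry_one hw hX (Y x) a b
  have e2 := extDeriv_curry_one hw hY (X x) a b
  rw [h] at e0
  rw [h1] at e1
  rw [h2] at e2
  rw [extDeriv_curry_two hw hX hY]
  have e3 : (-(w x).curryLeft (VectorField.lieBracket ℝ X Y x)) ![a, b] =
      -(w x ![fderiv ℝ Y x (X x), a, b] - w x ![fderiv ℝ X x (Y x), a, b]) := by
    rw [← ContinuousAlternatingMap.curryLeft_apply_apply, ← ContinuousAlternatingMap.curryLeft_apply_apply,
      VectorField.lieBracket_eq, map_sub]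
    rfl
  rw [e3]
  simp only [ContinuousAlternatingMap.coe_zero, Pi.zero_apply] at e0 e1 e2
  have s1 := swap12 (fderiv ℝ w x a) (X x) (Y x) b
  have s2 := swap12 (fderiv ℝ w x b) (X x) (Y x) a
  have s3 := swap12 (w x) (X x) (fderiv ℝ Y x a) b
  have s4 := swap12 (w x) (X x) (fderiv ℝ Y x b) a
  linarith

end Local
section Lie2

/-- The structure maps of a Lie 2-algebra on `W[1] ⊕ V`, with `V` in degree `0` and `W` in
degree `-1`: the unary bracket `δ`, the binary brackets `br x y = [x, y]` on `V` and
`act x h = [x, h] = -[h, x]`, and the trinary bracket `tri` on `V`.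
All other brackets vanish for degree reasons. -/
structure Lie2Brackets (V W : Type*) [AddCommGroup V] [Module ℝ V] [AddCommGroup W]
    [Module ℝ W] where
  δ : W →ₗ[ℝ] V
  br : V →ₗ[ℝ] V →ₗ[ℝ] V
  br_self : ∀ x, br x x = 0
  act : V →ₗ[ℝ] W →ₗ[ℝ] W
  tri : V [⋀^Fin 3]→ₗ[ℝ] W

/-- The higher Jacobi identities of an `L∞`-algebra, for `V` in degree `0` and `W` in
degree `-1`. -/
structure Lie2Brackets.IsLie2Algebra {V W : Type*} [AddCommGroup V] [Module ℝ V]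
    [AddCommGroup W] [Module ℝ W] (A : Lie2Brackets V W) : Prop where
  δ_act : ∀ x h, A.δ (A.act x h) = A.br x (A.δ h)
  act_δ : ∀ h k, A.act (A.δ h) k + A.act (A.δ k) h = 0
  jacobi : ∀ x y z, A.δ (A.tri ![x, y, z]) + A.br (A.br x y) z + A.br (A.br y z) x +
    A.br (A.br z x) y = 0
  jacobi_act : ∀ x y h, A.tri ![A.δ h, x, y] + A.act (A.br x y) h - A.act x (A.act y h) +
    A.act y (A.act x h) = 0
  cocycle : ∀ x y z u,
    A.act x (A.tri ![y, z, u]) - A.act y (A.tri ![x, z, u]) + A.act z (A.tri ![x, y, u]) -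
        A.act u (A.tri ![x, y, z]) =
      A.tri ![A.br x y, z, u] + A.tri ![y, A.br x z, u] + A.tri ![y, z, A.br x u] -
        A.tri ![x, A.br y z, u] - A.tri ![x, z, A.br y u] + A.tri ![x, y, A.br z u]

/-- The components of an `L∞`-morphism `W[1] ⊕ V → W'[1] ⊕ V'`: the unary component, which is
`f₀` on `V` and `f₁` on `W`, and the binary component `f₂`, of degree `-1`. -/
structure LInftyMap (V W V' W' : Type*) [AddCommGroup V] [Module ℝ V] [AddCommGroup W]
    [Module ℝ W] [AddCommGroup V'] [Module ℝ V'] [AddCommGroup W'] [Module ℝ W'] where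
  f₀ : V →ₗ[ℝ] V'
  f₁ : W →ₗ[ℝ] W'
  f₂ : V [⋀^Fin 2]→ₗ[ℝ] W'

/-- The equations of an `L∞`-morphism of Lie 2-algebras. -/
structure IsLInftyMorphism {V W V' W' : Type*} [AddCommGroup V] [Module ℝ V] [AddCommGroup W]
    [Module ℝ W] [AddCommGroup V'] [Module ℝ V'] [AddCommGroup W'] [Module ℝ W']
    (A : Lie2Brackets V W) (B : Lie2Brackets V' W') (F : LInftyMap V W V' W') : Prop where
  map_δ : ∀ h, B.δ (F.f₁ h) = F.f₀ (A.δ h)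
  map_br : ∀ x y, B.δ (F.f₂ ![x, y]) = F.f₀ (A.br x y) - B.br (F.f₀ x) (F.f₀ y)
  map_act : ∀ h x, F.f₂ ![A.δ h, x] = -F.f₁ (A.act x h) + B.act (F.f₀ x) (F.f₁ h)
  map_tri : ∀ x y z, F.f₁ (A.tri ![x, y, z]) - B.tri ![F.f₀ x, F.f₀ y, F.f₀ z] =
    F.f₂ ![x, A.br y z] - F.f₂ ![y, A.br x z] + F.f₂ ![z, A.br x y] +
      B.act (F.f₀ x) (F.f₂ ![y, z]) - B.act (F.f₀ y) (F.f₂ ![x, z]) +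
      B.act (F.f₀ z) (F.f₂ ![x, y])

/-- Composition of `L∞`-morphisms:
`(G ∘ F)₂(x, y) = G₁(F₂(x, y)) + G₂(F₁(x), F₁(y))`. -/
def LInftyMap.comp {V W V' W' V'' W'' : Type*} [AddCommGroup V] [Module ℝ V]
    [AddCommGroup W] [Module ℝ W] [AddCommGroup V'] [Module ℝ V'] [AddCommGroup W']
    [Module ℝ W'] [AddCommGroup V''] [Module ℝ V''] [AddCommGroup W''] [Module ℝ W'']
    (G : LInftyMap V' W' V'' W'') (F : LInftyMap V W V' W') : LInftyMap V W V'' W'' where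
  f₀ := G.f₀ ∘ₗ F.f₀
  f₁ := G.f₁ ∘ₗ F.f₁
  f₂ := G.f₁.compAlternatingMap F.f₂ + G.f₂.compLinearMap F.f₀

/-- The Lie 2-algebra `ℝ[1] ⊕_c g`: its only nonzero brackets are the Lie bracket of `g` and
the trinary bracket `c`. -/
def lie2Ext {g : Type*} [LieRing g] [LieAlgebra ℝ g] (c : g [⋀^Fin 3]→ₗ[ℝ] ℝ) :
    Lie2Brackets g ℝ where
  δ := 0
  br := LinearMap.mk₂ ℝ (fun x y => ⁅x, y⁆) add_lie smul_lie lie_add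
    (fun r x y => lie_smul r x y)
  br_self := lie_self
  act := 0
  tri := c

end Lie2

section CE
variable {g h : Type*} [AddCommGroup g] [Module ℝ g] [AddCommGroup h] [Module ℝ h]

/-- The degree of a homogeneous element of `h[2] ⊕ g[1]`, as counted in the
Chevalley-Eilenberg complex. A homogeneous element is `Sum.inl a` with `a ∈ h` (even) or
`Sum.inr x` with `x ∈ g` (odd). -/
def letterDeg : h ⊕ g → ℕ
  | Sum.inl _ => 2
  | Sum.inr _ => 1

/-- The Koszul sign of rearranging `w₀ ⋯ wₙ₋₁` into `w_{σ 0} ⋯ w_{σ (n-1)}`. -/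
def koszulSign {n : ℕ} (w : Fin n → h ⊕ g) (σ : Equiv.Perm (Fin n)) : ℝ :=
  ∏ i, ∏ j, if i < j ∧ σ j < σ i ∧ Odd (letterDeg (w (σ i))) ∧ Odd (letterDeg (w (σ j)))
    then -1 else 1

variable (g h) in
/-- Functions on the words of length `≥ 1` of homogeneous elements of `h[2] ⊕ g[1]`; the
component `k` is for words of length `k + 1`. -/
abbrev Cochain := ∀ k : ℕ, (Fin (k + 1) → h ⊕ g) → ℝ

variable (g h) in
/-- `CE(L)ⁿ`, the degree `n` part of `(S^{≥1}(h[2] ⊕ g[1]))^*`: cochains that are linear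
in each slot, graded symmetric, and vanish on all words whose degree is not `n`. -/
def CE (n : ℕ) : Submodule ℝ (Cochain g h) where
  carrier := {ξ | ∀ k (w : Fin (k + 1) → h ⊕ g),
    (∀ i, IsLinearMap ℝ (fun a : h => ξ k (Function.update w i (Sum.inl a))) ∧
      IsLinearMap ℝ (fun x : g => ξ k (Function.update w i (Sum.inr x)))) ∧
    (∀ σ : Equiv.Perm (Fin (k + 1)), ξ k (w ∘ σ) = koszulSign w σ * ξ k w) ∧
    (∑ i, letterDeg (w i) ≠ n → ξ k w = 0)}
  add_mem' := by
    intro ξ ζ hξ hζ k w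
    refine ⟨fun i => ⟨⟨fun a b => ?_, fun r a => ?_⟩, ⟨fun a b => ?_, fun r a => ?_⟩⟩,
      fun σ => ?_, fun hn => ?_⟩
    · simp only [Pi.add_apply, ((hξ k w).1 i).1.map_add, ((hζ k w).1 i).1.map_add]; ring
    · simp only [Pi.add_apply, ((hξ k w).1 i).1.map_smul, ((hζ k w).1 i).1.map_smul, smul_add]
    · simp only [Pi.add_apply, ((hξ k w).1 i).2.map_add, ((hζ k w).1 i).2.map_add]; ring
    · simp only [Pi.add_apply, ((hξ k w).1 i).2.map_smul, ((hζ k w).1 i).2.map_smul, smul_add]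
    · simp only [Pi.add_apply, (hξ k w).2.1 σ, (hζ k w).2.1 σ, mul_add]
    · simp only [Pi.add_apply, (hξ k w).2.2 hn, (hζ k w).2.2 hn, add_zero]
  zero_mem' := by
    intro k w
    exact ⟨fun i => ⟨⟨fun _ _ => by simp, fun _ _ => by simp⟩,
      ⟨fun _ _ => by simp, fun _ _ => by simp⟩⟩, fun σ => by simp, fun _ => rfl⟩
  smul_mem' := by
    intro c ξ hξ k w
    refine ⟨fun i => ⟨⟨fun a b => ?_, fun r a => ?_⟩, ⟨fun a b => ?_, fun r a => ?_⟩⟩,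
      fun σ => ?_, fun hn => ?_⟩
    · simp only [Pi.smul_apply, ((hξ k w).1 i).1.map_add, smul_add]
    · simp only [Pi.smul_apply, ((hξ k w).1 i).1.map_smul, smul_comm c r]
    · simp only [Pi.smul_apply, ((hξ k w).1 i).2.map_add, smul_add]
    · simp only [Pi.smul_apply, ((hξ k w).1 i).2.map_smul, smul_comm c r]
    · simp only [Pi.smul_apply, (hξ k w).2.1 σ, smul_eq_mul]; ring
    · simp only [Pi.smul_apply, (hξ k w).2.2 hn, smul_zero]

/-- The `(m, j)`-unshuffles. -/
def unshuffles (m j : ℕ) : Finset (Equiv.Perm (Fin (j + m))) :=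
  Finset.univ.filter fun σ => ∀ a b : Fin (j + m), a < b →
    (b.val < m ∨ m ≤ a.val) → σ a < σ b

/-- `ξ ∘ l`, where the `m`-ary operation `l` is extended to words of length `j + m` by
`w₀ ⋯ wₙ₋₁ ↦ ∑ ± l(w_{σ 0}, …, w_{σ (m-1)}) w_{σ m} ⋯ w_{σ (n-1)}`, the sum being over the
`(m, j)`-unshuffles, with Koszul signs. -/
def composeOp (m j : ℕ) (l : (Fin m → h ⊕ g) → h ⊕ g) (ξ : (Fin (j + 1) → h ⊕ g) → ℝ)
    (w : Fin (j + m) → h ⊕ g) : ℝ :=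
  ∑ σ ∈ unshuffles m j, koszulSign w σ *
    ξ (Fin.cons (l fun i => w (σ (Fin.castLE (Nat.le_add_left m j) i)))
      fun i : Fin j => w (σ (Fin.addNat i m)))

namespace Lie2Brackets
variable (L : Lie2Brackets g h)

/-- The unary operation on `h[2] ⊕ g[1]`. -/
def l₁ (w : Fin 1 → h ⊕ g) : h ⊕ g :=
  match w 0 with
  | Sum.inl a => Sum.inr (-L.δ a)
  | Sum.inr _ => Sum.inl 0

/-- The binary operation on `h[2] ⊕ g[1]`. -/
def l₂ (w : Fin 2 → h ⊕ g) : h ⊕ g :=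
  match w 0, w 1 with
  | Sum.inr x, Sum.inr y => Sum.inr (L.br x y)
  | Sum.inr x, Sum.inl a => Sum.inl (L.act x a)
  | Sum.inl a, Sum.inr x => Sum.inl (L.act x a)
  | Sum.inl _, Sum.inl _ => Sum.inl 0

/-- The trinary operation on `h[2] ⊕ g[1]`. -/
def l₃ (w : Fin 3 → h ⊕ g) : h ⊕ g :=
  match w 0, w 1, w 2 with
  | Sum.inr x, Sum.inr y, Sum.inr z => Sum.inl (-L.tri ![x, y, z])
  | _, _, _ => Sum.inl 0

/-- The Chevalley-Eilenberg differential `d = d₁ - d₂ + d₃` with `dᵢ ξ = ξ ∘ lᵢ`. -/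
def dCE (ξ : Cochain g h) : Cochain g h
  | 0, w => composeOp 1 0 L.l₁ (ξ 0) w
  | 1, w => composeOp 1 1 L.l₁ (ξ 1) w - composeOp 2 0 L.l₂ (ξ 0) w
  | k + 2, w => composeOp 1 (k + 2) L.l₁ (ξ (k + 2)) w - composeOp 2 (k + 1) L.l₂ (ξ (k + 1)) w
      + composeOp 3 k L.l₃ (ξ k) w

end Lie2Brackets

variable (h) in
/-- An alternating form on `g` in three arguments, as a cochain: it is extended by zero to
the words that are not of the form `x y z` with `x, y, z ∈ g`. -/
def threeCochain (c : g [⋀^Fin 3]→ₗ[ℝ] ℝ) : Cochain g h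
  | 2, w =>
    match w 0, w 1, w 2 with
    | Sum.inr x, Sum.inr y, Sum.inr z => c ![x, y, z]
    | _, _, _ => 0
  | _, _ => 0

/-- The component of `η ∈ CE(L)²` in `h[2]^*`. -/
def hPart (η : CE g h 2) : h →ₗ[ℝ] ℝ where
  toFun a := η.1 0 fun _ => Sum.inl a
  map_add' a b := by
    have h1 := (((η.2 0 fun _ => Sum.inl 0).1 0).1).map_add a b
    have h2 : ∀ a : h, Function.update (fun _ : Fin 1 => (Sum.inl 0 : h ⊕ g)) 0 (Sum.inl a) =
        fun _ => Sum.inl a := fun a => by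
      funext i; fin_cases i; rfl
    simpa only [Nat.reduceAdd, h2] using h1
  map_smul' r a := by
    have h1 := (((η.2 0 fun _ => Sum.inl 0).1 0).1).map_smul r a
    have h2 : ∀ a : h, Function.update (fun _ : Fin 1 => (Sum.inl 0 : h ⊕ g)) 0 (Sum.inl a) =
        fun _ => Sum.inl a := fun a => by
      funext i; fin_cases i; rfl
    simpa only [Nat.reduceAdd, h2, RingHom.id_apply] using h1

variable (h) in
theorem inr_update {n : ℕ} [inst : DecidableEq (Fin n)] (m : Fin n → g) (i : Fin n) (x : g) :
    (fun j => (Sum.inr (Function.update m i x j) : h ⊕ g)) =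
      @Function.update (Fin n) (fun _ => h ⊕ g) (instDecidableEqFin n) (fun j => Sum.inr (m j)) i
        (Sum.inr x) := by
  obtain rfl : inst = instDecidableEqFin n := Subsingleton.elim _ _
  exact funext fun j => Function.apply_update (fun _ (y : g) => (Sum.inr y : h ⊕ g)) m i x j

theorem koszulSign_swap (x y : g) :
    koszulSign (![Sum.inr x, Sum.inr y] : Fin 2 → h ⊕ g) (Equiv.swap 0 1) = -1 := by
  simp [koszulSign, Fin.prod_univ_two, letterDeg]

/-- The component of `η ∈ CE(L)²` in `S²(g[1])^*`, an alternating bilinear form on `g`. -/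
def ggPart (η : CE g h 2) : g [⋀^Fin 2]→ₗ[ℝ] ℝ where
  toFun m := η.1 1 fun i => Sum.inr (m i)
  map_update_add' m i x y := by
    have h1 := (((η.2 1 fun j => Sum.inr (m j)).1 i).2).map_add x y
    exact (congrArg (η.1 1) (inr_update h m i (x + y))).trans (h1.trans (congrArg₂ (· + ·)
      (congrArg (η.1 1) (inr_update h m i x).symm) (congrArg (η.1 1) (inr_update h m i y).symm)))
  map_update_smul' m i r x := by
    have h1 := (((η.2 1 fun j => Sum.inr (m j)).1 i).2).map_smul r x
    exact (congrArg (η.1 1) (inr_update h m i (r • x))).trans (h1.trans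
      (congrArg (fun t => r • η.1 1 t) (inr_update h m i x).symm))
  map_eq_zero_of_eq' m i j hm hij := by
    have h01 : m 0 = m 1 := by
      fin_cases i <;> fin_cases j <;> first | exact absurd rfl hij | exact hm | exact hm.symm
    have e : (fun i => Sum.inr (m i) : Fin 2 → h ⊕ g) = ![Sum.inr (m 0), Sum.inr (m 0)] := by
      funext i; fin_cases i
      · rfl
      · exact congrArg Sum.inr h01.symm
    have e2 : (![Sum.inr (m 0), Sum.inr (m 0)] : Fin 2 → h ⊕ g) ∘ Equiv.swap (0 : Fin 2) 1 =
        ![Sum.inr (m 0), Sum.inr (m 0)] := by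
      funext i; fin_cases i <;> rfl
    have h1 := (η.2 1 ![Sum.inr (m 0), Sum.inr (m 0)]).2.1 (Equiv.swap (0 : Fin 2) 1)
    have h2 := koszulSign_swap (h := h) (m 0) (m 0)
    change η.1 1 (fun i => Sum.inr (m i)) = 0
    rw [e]
    have h3 : η.1 1 ![Sum.inr (m 0), Sum.inr (m 0)] =
        -1 * η.1 1 ![Sum.inr (m 0), Sum.inr (m 0)] :=
      (congrArg (η.1 1) e2.symm).trans (h1.trans (congrArg (fun t => t * η.1 1 _) h2))
    linarith

/-- The map `W[1] ⊕ g → ℝ[1] ⊕ g` with unary component `(η|_h, id_g)` and binary component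
the restriction of `η` to `S²(g[1])`. -/
def inducedMap (η : CE g h 2) : LInftyMap g h g ℝ where
  f₀ := LinearMap.id
  f₁ := hPart η
  f₂ := ggPart η

end CE

section Forms
variable (E : Type*) [NormedAddCommGroup E] [NormedSpace ℝ E]
  (M : Type*) [TopologicalSpace M] [ChartedSpace E M]

/-- Families of alternating `k`-forms on the tangent spaces of `M`, no smoothness required. -/
abbrev FormField (k : ℕ) := M → E [⋀^Fin k]→L[ℝ] ℝ

variable {E M}

/-- The expression of `α` in the chart at `x₀`, i.e. its pullback under the inverse chart. -/
def inChart {k : ℕ} (α : FormField E M k) (x₀ : M) (u : E) : E [⋀^Fin k]→L[ℝ] ℝ :=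
  (α ((extChartAt 𝓘(ℝ, E) x₀).symm u)).compContinuousLinearMap
    (mfderiv 𝓘(ℝ, E) 𝓘(ℝ, E) (extChartAt 𝓘(ℝ, E) x₀).symm u)

/-- The exterior derivative, computed at `x` in the chart at `x`. -/
def dField {k : ℕ} (α : FormField E M k) : FormField E M (k + 1) := fun x =>
  (extDeriv (inChart α x) (extChartAt 𝓘(ℝ, E) x x)).compContinuousLinearMap
    (mfderiv 𝓘(ℝ, E) 𝓘(ℝ, E) (extChartAt 𝓘(ℝ, E) x) x)

/-- `α` is smooth: its expression in each chart is. -/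
def SmoothForm {k : ℕ} (α : FormField E M k) : Prop :=
  ∀ x₀ : M, ContDiffOn ℝ ∞ (inChart α x₀) (extChartAt 𝓘(ℝ, E) x₀).target

variable [IsManifold 𝓘(ℝ, E) ∞ M]

theorem mdiff_chart (x₀ : M) {y : M} (hy : y ∈ (extChartAt 𝓘(ℝ, E) x₀).source) :
    MDifferentiableAt 𝓘(ℝ, E) 𝓘(ℝ, E) (extChartAt 𝓘(ℝ, E) x₀) y :=
  mdifferentiableAt_extChartAt (by simpa using hy)

theorem mdiff_symm (x₀ : M) {u : E} (hu : u ∈ (extChartAt 𝓘(ℝ, E) x₀).target) :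
    MDifferentiableAt 𝓘(ℝ, E) 𝓘(ℝ, E) (extChartAt 𝓘(ℝ, E) x₀).symm u := by
  have := mdifferentiableWithinAt_extChartAt_symm (I := 𝓘(ℝ, E)) hu
  simpa [mdifferentiableWithinAt_univ] using this

theorem target_nhds (x₀ : M) {u : E} (hu : u ∈ (extChartAt 𝓘(ℝ, E) x₀).target) :
    (extChartAt 𝓘(ℝ, E) x₀).target ∈ 𝓝 u :=
  (isOpen_extChartAt_target x₀).mem_nhds hu

theorem mfderiv_symm_chart (x₀ : M) {u : E} (hu : u ∈ (extChartAt 𝓘(ℝ, E) x₀).target) :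
    (mfderiv 𝓘(ℝ, E) 𝓘(ℝ, E) (extChartAt 𝓘(ℝ, E) x₀).symm u) ∘L
      (mfderiv 𝓘(ℝ, E) 𝓘(ℝ, E) (extChartAt 𝓘(ℝ, E) x₀) ((extChartAt 𝓘(ℝ, E) x₀).symm u)) =
      ContinuousLinearMap.id ℝ _ := by
  have := mfderivWithin_extChartAt_symm_comp_mfderiv_extChartAt (I := 𝓘(ℝ, E)) hu
  simpa [mfderivWithin_univ] using this

theorem mfderiv_chart_symm (x₀ : M) {u : E} (hu : u ∈ (extChartAt 𝓘(ℝ, E) x₀).target) :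
    (mfderiv 𝓘(ℝ, E) 𝓘(ℝ, E) (extChartAt 𝓘(ℝ, E) x₀) ((extChartAt 𝓘(ℝ, E) x₀).symm u)) ∘L
    (mfderiv 𝓘(ℝ, E) 𝓘(ℝ, E) (extChartAt 𝓘(ℝ, E) x₀).symm u) =
      ContinuousLinearMap.id ℝ _ := by
  have := mfderiv_extChartAt_comp_mfderivWithin_extChartAt_symm (I := 𝓘(ℝ, E)) hu
  simpa [mfderivWithin_univ] using this

theorem symm_chart_apply (x₀ : M) {y : M} (hy : y ∈ (extChartAt 𝓘(ℝ, E) x₀).source) (w : E) :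
    (mfderiv 𝓘(ℝ, E) 𝓘(ℝ, E) (extChartAt 𝓘(ℝ, E) x₀).symm (extChartAt 𝓘(ℝ, E) x₀ y) : E →L[ℝ] E)
      ((mfderiv 𝓘(ℝ, E) 𝓘(ℝ, E) (extChartAt 𝓘(ℝ, E) x₀) y : E →L[ℝ] E) w) = w := by
  have := mfderivWithin_extChartAt_symm_comp_mfderiv_extChartAt' (I := 𝓘(ℝ, E)) hy
  simp only [modelWithCornersSelf_coe, Set.range_id, mfderivWithin_univ] at this
  exact congrArg (fun L : E →L[ℝ] E => L w) this

theorem formField_congr {k : ℕ} (α : FormField E M k) {y z : M} (h : y = z) {w w' : Fin k → E}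
    (hw : w = w') :
    (α y : E [⋀^Fin k]→L[ℝ] ℝ) w = (α z : E [⋀^Fin k]→L[ℝ] ℝ) w' := by subst h hw; rfl

theorem minSmooth_two_le : minSmoothness ℝ 2 ≤ (∞ : WithTop ℕ∞) := by
  rw [minSmoothness_of_isRCLikeNormedField]; exact WithTop.coe_le_coe.2 le_top

/-- change of charts -/
theorem inChart_change {k : ℕ} (α : FormField E M k) (x₀ x₁ : M) {u : E}
    (hu : u ∈ (extChartAt 𝓘(ℝ, E) x₀).target)
    (hu' : (extChartAt 𝓘(ℝ, E) x₀).symm u ∈ (extChartAt 𝓘(ℝ, E) x₁).source) :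
    inChart α x₀ u = (inChart α x₁ ((extChartAt 𝓘(ℝ, E) x₁ ∘ (extChartAt 𝓘(ℝ, E) x₀).symm) u)).compContinuousLinearMap
      (fderiv ℝ (extChartAt 𝓘(ℝ, E) x₁ ∘ (extChartAt 𝓘(ℝ, E) x₀).symm) u) := by
  have h1 : mfderiv 𝓘(ℝ, E) 𝓘(ℝ, E) (extChartAt 𝓘(ℝ, E) x₁ ∘ (extChartAt 𝓘(ℝ, E) x₀).symm) u =
    (mfderiv 𝓘(ℝ, E) 𝓘(ℝ, E) (extChartAt 𝓘(ℝ, E) x₁) ((extChartAt 𝓘(ℝ, E) x₀).symm u)) ∘L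
    (mfderiv 𝓘(ℝ, E) 𝓘(ℝ, E) (extChartAt 𝓘(ℝ, E) x₀).symm u) :=
    mfderiv_comp u (mdiff_chart x₁ hu') (mdiff_symm x₀ hu)
  rw [← mfderiv_eq_fderiv, h1]
  ext v
  exact formField_congr α ((extChartAt 𝓘(ℝ, E) x₁).left_inv hu').symm
    (funext fun i => (symm_chart_apply x₁ hu' _).symm)

theorem contDiffAt_change (x₀ x₁ : M) {u : E}
    (hu : u ∈ (extChartAt 𝓘(ℝ, E) x₀).target)
    (hu' : (extChartAt 𝓘(ℝ, E) x₀).symm u ∈ (extChartAt 𝓘(ℝ, E) x₁).source) :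
    ContDiffAt ℝ ∞ (extChartAt 𝓘(ℝ, E) x₁ ∘ (extChartAt 𝓘(ℝ, E) x₀).symm) u := by
  rw [← contMDiffAt_iff_contDiffAt]
  refine ContMDiffAt.comp u (contMDiffAt_extChartAt' (by simpa using hu')) ?_
  exact (contMDiffOn_extChartAt_symm x₀).contMDiffAt (target_nhds x₀ hu)

theorem eventually_change (x₀ x₁ : M) {u : E}
    (hu : u ∈ (extChartAt 𝓘(ℝ, E) x₀).target)
    (hu' : (extChartAt 𝓘(ℝ, E) x₀).symm u ∈ (extChartAt 𝓘(ℝ, E) x₁).source) :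
    ∀ᶠ w in 𝓝 u, w ∈ (extChartAt 𝓘(ℝ, E) x₀).target ∧
      (extChartAt 𝓘(ℝ, E) x₀).symm w ∈ (extChartAt 𝓘(ℝ, E) x₁).source :=
  (Filter.Eventually.and (target_nhds x₀ hu)) <| (continuousAt_extChartAt_symm'' hu).eventually
    ((isOpen_extChartAt_source x₁).mem_nhds hu')

theorem SmoothForm.contDiffAt {k : ℕ} {α : FormField E M k} (hα : SmoothForm α) (x₀ : M) {u : E}
    (hu : u ∈ (extChartAt 𝓘(ℝ, E) x₀).target) : ContDiffAt ℝ ∞ (inChart α x₀) u :=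
  (hα x₀).contDiffAt (target_nhds x₀ hu)

theorem SmoothForm.differentiableAt {k : ℕ} {α : FormField E M k} (hα : SmoothForm α) (x₀ : M) {u : E}
    (hu : u ∈ (extChartAt 𝓘(ℝ, E) x₀).target) : DifferentiableAt ℝ (inChart α x₀) u :=
  (hα.contDiffAt x₀ hu).differentiableAt (by simp)

/-- The exterior derivative is computed by `extDeriv` in every chart. -/
theorem inChart_dField {k : ℕ} {α : FormField E M k} (hα : SmoothForm α) (x₀ : M) {u : E}
    (hu : u ∈ (extChartAt 𝓘(ℝ, E) x₀).target) :
    inChart (dField α) x₀ u = extDeriv (inChart α x₀) u := by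
  set x₁ := (extChartAt 𝓘(ℝ, E) x₀).symm u with hx₁
  have hu' : (extChartAt 𝓘(ℝ, E) x₀).symm u ∈ (extChartAt 𝓘(ℝ, E) x₁).source :=
    mem_extChartAt_source _
  have h2 : inChart α x₀ =ᶠ[𝓝 u] fun w => (inChart α x₁ ((extChartAt 𝓘(ℝ, E) x₁ ∘ (extChartAt 𝓘(ℝ, E) x₀).symm) w)).compContinuousLinearMap
      (fderiv ℝ (extChartAt 𝓘(ℝ, E) x₁ ∘ (extChartAt 𝓘(ℝ, E) x₀).symm) w) :=
    (eventually_change x₀ x₁ hu hu').mono fun w hw => inChart_change α x₀ x₁ hw.1 hw.2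
  have h1 : mfderiv 𝓘(ℝ, E) 𝓘(ℝ, E) (extChartAt 𝓘(ℝ, E) x₁ ∘ (extChartAt 𝓘(ℝ, E) x₀).symm) u =
    (mfderiv 𝓘(ℝ, E) 𝓘(ℝ, E) (extChartAt 𝓘(ℝ, E) x₁) ((extChartAt 𝓘(ℝ, E) x₀).symm u)) ∘L
    (mfderiv 𝓘(ℝ, E) 𝓘(ℝ, E) (extChartAt 𝓘(ℝ, E) x₀).symm u) :=
    mfderiv_comp u (mdiff_chart x₁ hu') (mdiff_symm x₀ hu)
  rw [h2.extDeriv_eq]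
  refine Eq.trans ?_ (extDeriv_pullback (r := ∞)
    (f := extChartAt 𝓘(ℝ, E) x₁ ∘ (extChartAt 𝓘(ℝ, E) x₀).symm)
    (hα.differentiableAt x₁ (mem_extChartAt_target x₁))
    (contDiffAt_change x₀ x₁ hu hu') minSmooth_two_le).symm
  rw [← mfderiv_eq_fderiv, h1]
  rfl

theorem SmoothForm.dField {k : ℕ} {α : FormField E M k} (hα : SmoothForm α) :
    SmoothForm (dField α) := by
  intro x₀
  have h : ContDiffOn ℝ ∞ (extDeriv (inChart α x₀)) (extChartAt 𝓘(ℝ, E) x₀).target := by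
    intro u hu
    have h1 : ContDiffAt ℝ ∞ (fderiv ℝ (inChart α x₀)) u :=
      (hα.contDiffAt x₀ hu).fderiv_right (by simp)
    exact ((ContinuousAlternatingMap.alternatizeUncurryFinCLM ℝ E ℝ).contDiff.contDiffAt.comp u h1).contDiffWithinAt
  exact h.congr fun u hu => inChart_dField hα x₀ hu

theorem inChart_self {k : ℕ} (α : FormField E M k) (x : M) :
    inChart α x (extChartAt 𝓘(ℝ, E) x x) = α x := by
  ext v
  refine formField_congr α (extChartAt_to_inv x) (funext fun i => ?_)
  have := mfderivWithin_range_extChartAt_symm (I := 𝓘(ℝ, E)) (x := x)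
  simp only [modelWithCornersSelf_coe, Set.range_id, mfderivWithin_univ] at this
  exact congrArg (fun L : E →L[ℝ] E => L (v i)) this

theorem dField_apply {k : ℕ} {α : FormField E M k} (hα : SmoothForm α) (x : M) :
    dField α x = extDeriv (inChart α x) (extChartAt 𝓘(ℝ, E) x x) := by
  rw [← inChart_dField hα x (mem_extChartAt_target x), inChart_self]

theorem dField_dField {k : ℕ} {α : FormField E M k} (hα : SmoothForm α) :
    MomentMap.dField (MomentMap.dField α) = 0 := by
  funext x
  have ht := mem_extChartAt_target (I := 𝓘(ℝ, E)) x
  rw [dField_apply hα.dField]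
  have : inChart (MomentMap.dField α) x =ᶠ[𝓝 (extChartAt 𝓘(ℝ, E) x x)] extDeriv (inChart α x) :=
    Filter.Eventually.mono (target_nhds x ht) fun u hu => inChart_dField hα x hu
  rw [this.extDeriv_eq, extDeriv_extDeriv_apply (hα.contDiffAt x ht) (r := ∞) minSmooth_two_le]
  rfl


variable (E M) in
/-- Smooth vector fields on `M`. -/
abbrev VField := Cₛ^∞⟮𝓘(ℝ, E); E, (TangentSpace 𝓘(ℝ, E) : M → Type _)⟯

/-- The expression of a vector field in the chart at `x₀`. -/
def vfInChart (X : VField E M) (x₀ : M) : E → E :=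
  VectorField.mpullback 𝓘(ℝ, E) 𝓘(ℝ, E) (extChartAt 𝓘(ℝ, E) x₀).symm X

theorem invertible_symm (x₀ : M) {u : E} (hu : u ∈ (extChartAt 𝓘(ℝ, E) x₀).target) :
    (mfderiv 𝓘(ℝ, E) 𝓘(ℝ, E) (extChartAt 𝓘(ℝ, E) x₀).symm u).IsInvertible := by
  have := isInvertible_mfderivWithin_extChartAt_symm (I := 𝓘(ℝ, E)) hu
  simpa [mfderivWithin_univ] using this

theorem contDiffAt_vfInChart [CompleteSpace E] (X : VField E M) (x₀ : M) {u : E}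
    (hu : u ∈ (extChartAt 𝓘(ℝ, E) x₀).target) : ContDiffAt ℝ ∞ (vfInChart X x₀) u := by
  refine contMDiffAt_vectorSpace_iff_contDiffAt.1 ?_
  exact ContMDiffAt.mpullback_vectorField_preimage (n := ∞) X.contMDiff.contMDiffAt
    ((contMDiffOn_extChartAt_symm x₀).contMDiffAt (target_nhds x₀ hu))
    (invertible_symm x₀ hu) (by simp)

theorem symm_vfInChart (X : VField E M) (x₀ : M) {u : E}
    (hu : u ∈ (extChartAt 𝓘(ℝ, E) x₀).target) :
    (mfderiv 𝓘(ℝ, E) 𝓘(ℝ, E) (extChartAt 𝓘(ℝ, E) x₀).symm u : E →L[ℝ] E)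
      (vfInChart (E := E) X x₀ u) =
      X ((extChartAt 𝓘(ℝ, E) x₀).symm u) := by
  obtain ⟨L, hL⟩ := invertible_symm x₀ hu
  simp only [vfInChart, VectorField.mpullback_apply]
  rw [← hL, ContinuousLinearMap.inverse_equiv]
  exact L.apply_symm_apply _

/-- The interior product `ι_X α`, pointwise. -/
def contractField {k : ℕ} (X : VField E M) (α : FormField E M (k + 1)) : FormField E M k :=
  fun x => ContinuousAlternatingMap.curryLeft (E := E) (α x) (X x)

theorem inChart_contract {k : ℕ} (X : VField E M) (α : FormField E M (k + 1)) (x₀ : M) {u : E}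
    (hu : u ∈ (extChartAt 𝓘(ℝ, E) x₀).target) :
    inChart (contractField X α) x₀ u = (inChart α x₀ u).curryLeft (vfInChart X x₀ u) := by
  ext v
  have h : ∀ y : E, y = X ((extChartAt 𝓘(ℝ, E) x₀).symm u) → contractField X α ((extChartAt 𝓘(ℝ, E) x₀).symm u) =
     ContinuousAlternatingMap.curryLeft (E := E) (α ((extChartAt 𝓘(ℝ, E) x₀).symm u)) y := by
    rintro y rfl; rfl
  have h2 := (ContinuousAlternatingMap.curryLeft_compContinuousLinearMap (E := E) (F := E)
    (α ((extChartAt 𝓘(ℝ, E) x₀).symm u))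
    (mfderiv 𝓘(ℝ, E) 𝓘(ℝ, E) (extChartAt 𝓘(ℝ, E) x₀).symm u) (vfInChart X x₀ u))
  refine Eq.trans ?_ (congrArg (fun a : E [⋀^Fin k]→L[ℝ] ℝ => a v) h2.symm)
  rw [inChart, h _ (symm_vfInChart X x₀ hu)]
  rfl

theorem SmoothForm.contract [CompleteSpace E] {k : ℕ} {α : FormField E M (k + 1)} (hα : SmoothForm α)
    (X : VField E M) : SmoothForm (contractField X α) := fun x₀ _ hu =>
  ((contDiffAt_curryLeft (hα.contDiffAt x₀ hu) (contDiffAt_vfInChart X x₀ hu)).congr_of_eventuallyEq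
    (Filter.Eventually.mono (target_nhds x₀ hu)
      fun _ hw => inChart_contract X α x₀ hw)).contDiffWithinAt

theorem mlieBracket_inChart (X Y : VField E M) (x : M) :
    VectorField.mlieBracket 𝓘(ℝ, E) X Y x =
      VectorField.lieBracket ℝ (vfInChart X x) (vfInChart Y x) (extChartAt 𝓘(ℝ, E) x x) := by
  rw [← VectorField.mlieBracketWithin_univ, VectorField.mlieBracketWithin_apply, mfderiv_extChartAt_self]
  simp only [modelWithCornersSelf_coe, Set.range_id, VectorField.mpullbackWithin_univ,
    Set.preimage_univ, Set.univ_inter]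
  rw [← VectorField.lieBracketWithin_univ]
  exact congrArg (fun L : E →L[ℝ] E => L (VectorField.lieBracketWithin ℝ (vfInChart X x)
    (vfInChart Y x) Set.univ (extChartAt 𝓘(ℝ, E) x x))) ContinuousLinearMap.inverse_id


theorem SmoothForm.add {k : ℕ} {α β : FormField E M k} (hα : SmoothForm α) (hβ : SmoothForm β) :
    SmoothForm (α + β) := fun x₀ => (hα x₀).add (hβ x₀)

theorem SmoothForm.smul {k : ℕ} {α : FormField E M k} (r : ℝ) (hα : SmoothForm α) :
    SmoothForm (r • α) := fun x₀ =>
  (contDiffOn_const (c := r)).smul (hα x₀)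

theorem smoothForm_zero {k : ℕ} : SmoothForm (0 : FormField E M k) := fun x₀ =>
  contDiffOn_const (𝕜 := ℝ) (n := ∞) (s := (extChartAt 𝓘(ℝ, E) x₀).target)
    (c := (0 : E [⋀^Fin k]→L[ℝ] ℝ))

variable (E M) in
/-- The subspace of smooth families of alternating `k`-forms. -/
def DFormSub (k : ℕ) : Submodule ℝ (FormField E M k) where
  carrier := {α | SmoothForm α}
  add_mem' := SmoothForm.add
  zero_mem' := smoothForm_zero
  smul_mem' r _ h := SmoothForm.smul r h

variable (E M) in
/-- `Ω^k(M)`: smooth differential `k`-forms on `M`. -/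
def DForm (k : ℕ) : Type _ := DFormSub E M k

instance (k : ℕ) : AddCommGroup (DForm E M k) := inferInstanceAs (AddCommGroup (DFormSub E M k))

instance (k : ℕ) : Module ℝ (DForm E M k) := inferInstanceAs (Module ℝ (DFormSub E M k))

theorem dField_add {k : ℕ} {α β : FormField E M k} (hα : SmoothForm α) (hβ : SmoothForm β) :
    dField (α + β) = dField α + dField β := by
  funext x
  have ht := mem_extChartAt_target (I := 𝓘(ℝ, E)) x
  rw [dField_apply (hα.add hβ)]
  refine (extDeriv_add (hα.differentiableAt x ht) (hβ.differentiableAt x ht)).trans ?_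
  rw [← dField_apply hα, ← dField_apply hβ]
  rfl

theorem dField_smul {k : ℕ} (r : ℝ) {α : FormField E M k} (hα : SmoothForm α) :
    dField (r • α) = r • dField α := by
  funext x
  rw [dField_apply (hα.smul r)]
  refine (extDeriv_smul r (inChart α x)).trans ?_
  rw [← dField_apply hα]
  rfl

/-- The de Rham differential `d : Ω^k(M) → Ω^{k+1}(M)`. -/
def dForm (k : ℕ) : DForm E M k →ₗ[ℝ] DForm E M (k + 1) where
  toFun α := ⟨dField α.1, SmoothForm.dField α.2⟩
  map_add' α β := Subtype.ext (dField_add α.2 β.2)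
  map_smul' r α := Subtype.ext (dField_smul r α.2)

theorem dForm_dForm {k : ℕ} (α : DForm E M k) : dForm (k + 1) (dForm k α) = 0 :=
  Subtype.ext (dField_dField α.2)

variable [CompleteSpace E]

theorem curryLeft_add_arg {k : ℕ} (a : E [⋀^Fin (k + 1)]→L[ℝ] ℝ) (x y : E) :
    a.curryLeft (x + y) = a.curryLeft x + a.curryLeft y := map_add _ _ _

theorem curryLeft_smul_arg {k : ℕ} (a : E [⋀^Fin (k + 1)]→L[ℝ] ℝ) (r : ℝ) (x : E) :
    a.curryLeft (r • x) = r • a.curryLeft x := map_smul _ _ _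

/-- The interior product `(X, α) ↦ ι_X α = α(X, ·, …, ·)`. -/
def ι {k : ℕ} : VField E M →ₗ[ℝ] DForm E M (k + 1) →ₗ[ℝ] DForm E M k :=
  LinearMap.mk₂ ℝ (fun X α => ⟨contractField X α.1, SmoothForm.contract α.2 X⟩)
    (fun X Y α => Subtype.ext (funext fun x => curryLeft_add_arg (E := E) (α.1 x) (X x) (Y x)))
    (fun r X α => Subtype.ext (funext fun x => curryLeft_smul_arg (E := E) (α.1 x) r (X x)))
    (fun _ _ _ => rfl) (fun _ _ _ => rfl)

variable (E M) in
/-- `C^∞(M)`. -/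
abbrev SmoothFun := C^∞⟮𝓘(ℝ, E), M; 𝓘(ℝ, ℝ), ℝ⟯

/-- A smooth function, viewed as a `0`-form. -/
def zeroForm : SmoothFun E M →ₗ[ℝ] DForm E M 0 where
  toFun f := ⟨fun x => ContinuousAlternatingMap.constOfIsEmpty ℝ _ (Fin 0) (f x), by
    intro x₀ u hu
    have h : ContDiffAt ℝ ∞ (fun u => f ((extChartAt 𝓘(ℝ, E) x₀).symm u)) u := by
      refine contMDiffAt_iff_contDiffAt.1 ?_
      exact f.contMDiff.contMDiffAt.comp u
        ((contMDiffOn_extChartAt_symm x₀).contMDiffAt (target_nhds x₀ hu))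
    exact ((ContinuousAlternatingMap.constOfIsEmptyLIE ℝ E ℝ (Fin 0)).contDiff.contDiffAt.comp u
      h).contDiffWithinAt⟩
  map_add' f g := by
    refine Subtype.ext (funext fun x => ?_)
    ext v
    rfl
  map_smul' r f := by
    refine Subtype.ext (funext fun x => ?_)
    ext v
    rfl

theorem SmoothForm.contMDiff_zero {α : FormField E M 0} (hα : SmoothForm α) (v : Fin 0 → E) :
    ContMDiff 𝓘(ℝ, E) 𝓘(ℝ, ℝ) ∞ (fun x => (α x : E [⋀^Fin 0]→L[ℝ] ℝ) v) := by
  intro x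
  have ht := mem_extChartAt_target (I := 𝓘(ℝ, E)) x
  have h : ContDiffAt ℝ ∞ (fun u => inChart α x u v) (extChartAt 𝓘(ℝ, E) x x) :=
    (ContinuousAlternatingMap.apply ℝ E ℝ v).contDiff.contDiffAt.comp _ (hα.contDiffAt x ht)
  have h2 : ContMDiffAt 𝓘(ℝ, E) 𝓘(ℝ, ℝ) ∞
      ((fun u => inChart α x u v) ∘ extChartAt 𝓘(ℝ, E) x) x :=
    (contMDiffAt_iff_contDiffAt.2 h).comp x contMDiffAt_extChartAt
  refine h2.congr_of_eventuallyEq ?_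
  filter_upwards [extChartAt_source_mem_nhds (I := 𝓘(ℝ, E)) x] with y hy
  exact formField_congr α ((extChartAt 𝓘(ℝ, E) x).left_inv hy).symm (Subsingleton.elim _ _)

theorem SmoothForm.contMDiff_eval {k : ℕ} {α : FormField E M k} (hα : SmoothForm α)
    (X : Fin k → VField E M) :
    ContMDiff 𝓘(ℝ, E) 𝓘(ℝ, ℝ) ∞ (fun x => α x fun i => X i x) := by
  induction k with
  | zero =>
    refine (hα.contMDiff_zero Fin.elim0).congr fun x => ?_
    exact formField_congr α rfl (Subsingleton.elim _ _)
  | succ k ih =>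
    refine (ih (hα.contract (X 0)) (fun i => X i.succ)).congr fun x => ?_
    refine formField_congr α rfl (funext fun i => ?_)
    refine Fin.cases ?_ (fun i => ?_) i <;> rfl

/-- The function `α(X₁, …, X_k)`. -/
def evalForm {k : ℕ} (α : DForm E M k) : VField E M [⋀^Fin k]→ₗ[ℝ] SmoothFun E M where
  toFun X := ⟨fun x => α.1 x fun i => X i x, SmoothForm.contMDiff_eval α.2 X⟩
  map_update_add' m i X Y := by
    ext x
    have h : ∀ Z : VField E M, (fun j => Function.update m i Z j x) =
        Function.update (fun j => m j x) i (Z x) := fun Z =>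
      funext fun j => Function.apply_update (fun _ (W : VField E M) => W x) m i Z j
    change α.1 x _ = α.1 x _ + α.1 x _
    rw [h, h, h]
    exact (α.1 x).map_update_add _ i _ _
  map_update_smul' m i r X := by
    ext x
    have h : ∀ Z : VField E M, (fun j => Function.update m i Z j x) =
        Function.update (fun j => m j x) i (Z x) := fun Z =>
      funext fun j => Function.apply_update (fun _ (W : VField E M) => W x) m i Z j
    change α.1 x _ = r • α.1 x _
    rw [h, h]
    exact (α.1 x).map_update_smul _ i _ _
  map_eq_zero_of_eq' m i j hm hij := by
    ext x
    exact (α.1 x).map_eq_zero_of_eq _ (congrArg (fun W : VField E M => W x) hm) hij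


/-- `d f` for a smooth function `f`. -/
def dFun : SmoothFun E M →ₗ[ℝ] DForm E M 1 := dForm 0 ∘ₗ zeroForm

variable (E M) in
/-- `H¹(M)`: closed 1-forms modulo the differentials of smooth functions. -/
abbrev DeRham1 : Type _ :=
  LinearMap.ker (dForm (E := E) (M := M) 1) ⧸
    (LinearMap.range (dFun (E := E) (M := M))).comap (LinearMap.ker (dForm (E := E) (M := M) 1)).subtype

/-- The commutator `[X, Y]` of smooth vector fields. -/
def vfBracket (X Y : VField E M) : VField E M :=
  ⟨VectorField.mlieBracket 𝓘(ℝ, E) X Y, fun x =>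
    haveI : IsManifold 𝓘(ℝ, E) (minSmoothness ℝ 2) M := IsManifold.of_le minSmooth_two_le
    haveI : IsManifold 𝓘(ℝ, E) (∞ + 1) M := IsManifold.of_le (n := ∞) (by simp)
    ContMDiffAt.mlieBracket_vectorField (m := ⊤) (n := ⊤) (X.contMDiff x) (Y.contMDiff x)
      (by rw [minSmoothness_of_isRCLikeNormedField]; simp)⟩

theorem dForm_ι_ι {α : DForm E M 3} {X Y : VField E M} (h : dForm 3 α = 0)
    (hX : dForm 2 (ι X α) = 0) (hY : dForm 2 (ι Y α) = 0) :
    dForm 1 (ι Y (ι X α)) = -ι (vfBracket X Y) α := by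
  refine Subtype.ext (funext fun x => ?_)
  have ht := mem_extChartAt_target (I := 𝓘(ℝ, E)) x
  have hn := target_nhds x ht
  have e : ∀ {k : ℕ} (β : DForm E M k), dForm k β = 0 →
      extDeriv (inChart β.1 x) (extChartAt 𝓘(ℝ, E) x x) = 0 := fun β hβ => by
    rw [← dField_apply β.2]; exact congrArg (fun γ : DForm E M _ => γ.1 x) hβ
  have e1 : ∀ Z : VField E M, inChart (ι Z α).1 x =ᶠ[𝓝 (extChartAt 𝓘(ℝ, E) x x)]
      fun u => (inChart α.1 x u).curryLeft (vfInChart Z x u) := fun Z =>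
    Filter.Eventually.mono hn fun u hu => inChart_contract Z α.1 x hu
  have e2 : inChart (ι Y (ι X α)).1 x =ᶠ[𝓝 (extChartAt 𝓘(ℝ, E) x x)]
      fun u => ((inChart α.1 x u).curryLeft (vfInChart X x u)).curryLeft (vfInChart Y x u) :=
    Filter.Eventually.mono hn fun u hu => (inChart_contract Y (ι X α).1 x hu).trans
      (by
        have := inChart_contract X α.1 x hu
        exact congrArg (fun a : E [⋀^Fin 2]→L[ℝ] ℝ => a.curryLeft (vfInChart Y x u)) this)
  have hX' := e _ hX
  have hY' := e _ hY
  rw [(e1 X).extDeriv_eq] at hX'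
  rw [(e1 Y).extDeriv_eq] at hY'
  have key := extDeriv_bracket (SmoothForm.differentiableAt α.2 x ht)
    ((contDiffAt_vfInChart X x ht).differentiableAt (by simp))
    ((contDiffAt_vfInChart Y x ht).differentiableAt (by simp)) (e α h) hX' hY'
  refine (dField_apply (ι Y (ι X α)).2 x).trans ?_
  rw [e2.extDeriv_eq, key, inChart_self]
  have h3 := mlieBracket_inChart X Y x
  change _ = -ContinuousAlternatingMap.curryLeft (E := E) (α.1 x)
    (VectorField.mlieBracket 𝓘(ℝ, E) X Y x)
  rw [h3]

variable (E M) in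
/-- A 2-plectic form: a closed 3-form `ω` such that `v ↦ ι_v ω` is injective on each `T_xM`. -/
structure TwoPlectic where
  form : DForm E M 3
  closed : dForm 3 form = 0
  nondegenerate : ∀ (x : M) (v : TangentSpace 𝓘(ℝ, E) x),
    (∀ a b : TangentSpace 𝓘(ℝ, E) x, form.1 x ![v, a, b] = 0) → v = 0

namespace TwoPlectic
variable (P : TwoPlectic E M)

/-- `X` is a Hamiltonian vector field of `α`. -/
def IsHamVF (α : DForm E M 1) (X : VField E M) : Prop := dForm 1 α = -ι X P.form

/-- `Ω¹_Ham(M)`. -/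
def Ham : Submodule ℝ (DForm E M 1) where
  carrier := {α | ∃ X, P.IsHamVF α X}
  add_mem' := by
    rintro α β ⟨X, hX⟩ ⟨Y, hY⟩
    exact ⟨X + Y, by rw [IsHamVF] at *; rw [map_add, hX, hY, map_add, LinearMap.add_apply]; abel⟩
  zero_mem' := ⟨0, by simp [IsHamVF]⟩
  smul_mem' := by
    rintro r α ⟨X, hX⟩
    exact ⟨r • X, by rw [IsHamVF] at *; rw [map_smul, hX, map_smul, LinearMap.smul_apply, smul_neg]⟩

theorem ι_injective {X Y : VField E M} (h : ι X P.form = ι Y P.form) : X = Y := by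
  rw [← sub_eq_zero]
  ext x
  refine P.nondegenerate x _ fun a b => ?_
  have h2 : ι (X - Y) P.form = 0 := by rw [map_sub, LinearMap.sub_apply, h, sub_self]
  exact congrArg (fun γ : DForm E M 2 => γ.1 x ![a, b]) h2

theorem IsHamVF.unique {P : TwoPlectic E M} {α : DForm E M 1} {X Y : VField E M}
    (hX : P.IsHamVF α X) (hY : P.IsHamVF α Y) : X = Y :=
  P.ι_injective (neg_injective (hX.symm.trans hY))

theorem exists_hamVF (α : P.Ham) : ∃ X, P.IsHamVF α.1 X := α.2

theorem isHamVF_choose (α : P.Ham) : P.IsHamVF α.1 (P.exists_hamVF α).choose :=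
  (P.exists_hamVF α).choose_spec

/-- The Hamiltonian vector field `v_α` of `α ∈ Ω¹_Ham(M)`. -/
def hamVF : P.Ham →ₗ[ℝ] VField E M where
  toFun α := (P.exists_hamVF α).choose
  map_add' α β := by
    refine (P.isHamVF_choose (α + β)).unique ?_
    have h1 := P.isHamVF_choose α
    have h2 := P.isHamVF_choose β
    rw [IsHamVF] at *
    rw [map_add, LinearMap.add_apply, neg_add, ← h1, ← h2, ← map_add]
    rfl
  map_smul' r α := by
    refine (P.isHamVF_choose (r • α)).unique ?_
    have h1 := P.isHamVF_choose α
    rw [IsHamVF] at *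
    rw [map_smul, LinearMap.smul_apply, ← smul_neg, RingHom.id_apply, ← h1, ← map_smul]
    rfl

theorem isHamVF_hamVF (α : P.Ham) : P.IsHamVF α.1 (P.hamVF α) := P.isHamVF_choose α

theorem IsHamVF.closed {P : TwoPlectic E M} {α : DForm E M 1} {X : VField E M}
    (hX : P.IsHamVF α X) : dForm 2 (ι X P.form) = 0 := by
  have h : ι X P.form = -dForm 1 α := by rw [hX, neg_neg]
  rw [h, map_neg, dForm_dForm, neg_zero]

theorem bracket_mem (α β : P.Ham) : ι (P.hamVF β) (ι (P.hamVF α) P.form) ∈ P.Ham :=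
  ⟨vfBracket (P.hamVF α) (P.hamVF β),
    dForm_ι_ι P.closed (P.isHamVF_hamVF α).closed (P.isHamVF_hamVF β).closed⟩

/-- The brackets of `L∞(M, ω)`, with `Ω¹_Ham(M)` in degree `0` and `C^∞(M)` in degree `-1`:
`δ f = d f`, `[α, β]' = ω(v_α, v_β, ·)`, `[α, β, γ]' = -ω(v_α, v_β, v_γ)`. -/
def observables : Lie2Brackets P.Ham (SmoothFun E M) where
  δ := LinearMap.codRestrict P.Ham dFun fun f => ⟨0, by
    rw [IsHamVF, map_zero, LinearMap.zero_apply, neg_zero]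
    exact dForm_dForm _⟩
  br := LinearMap.mk₂ ℝ (fun α β => ⟨ι (P.hamVF β) (ι (P.hamVF α) P.form), P.bracket_mem α β⟩)
    (fun α β γ => Subtype.ext (by simp))
    (fun r α β => Subtype.ext (by simp))
    (fun α β γ => Subtype.ext (by simp))
    (fun r α β => Subtype.ext (by simp))
  br_self α := Subtype.ext <| Subtype.ext <| funext fun x => by
    ext v
    exact (P.form.1 x).map_eq_zero_of_eq _ (i := 0) (j := 1) rfl (by decide)
  act := 0
  tri := -(evalForm P.form).compLinearMap P.hamVF

/-- `F` is a moment map, for the Lie 2-algebra `A` with degree `0` part `V`, of the Hamiltonian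
vector fields `v x`, `x ∈ V`. -/
def IsMomentMap {V W : Type*} [AddCommGroup V] [Module ℝ V] [AddCommGroup W] [Module ℝ W]
    (A : Lie2Brackets V W) (v : V → VField E M) (F : LInftyMap V W P.Ham (SmoothFun E M)) :
    Prop :=
  IsLInftyMorphism A P.observables F ∧ ∀ x, P.IsHamVF (F.f₀ x).1 (v x)

/-- `ω_{3p}(x, y, z) = ω(v_x, v_y, v_z)|_p`. -/
def threeForm {g : Type*} [AddCommGroup g] [Module ℝ g] (v : g →ₗ[ℝ] VField E M) (p : M) :
    g [⋀^Fin 3]→ₗ[ℝ] ℝ :=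
  ({ toFun := fun f => f p, map_add' := fun _ _ => rfl, map_smul' := fun _ _ => rfl } :
    SmoothFun E M →ₗ[ℝ] ℝ).compAlternatingMap ((evalForm P.form).compLinearMap v)

end TwoPlectic

end Forms
end MomentMap

end

open MomentMap

/-!
The form `γ₁([x, y]) - ω(v_x, v_y, ·)` is closed, because `ω(v_x, v_y, ·)` is Hamiltonian with vector
field `[v_x, v_y] = v_{[x, y]}`. Since `H¹(M) = 0`, it has a primitive, and since `M` is connected,
exactly one that vanishes at `p` (`eq_of_dFun_eq`, `primitiveAt`); uniqueness makes the primitive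
linear in the form. This is `γ₂`.

All equations of an `L∞`-morphism for `γ` are immediate except the trinary one, which says that the
function `ω(v_x, v_y, v_z) - ω_{3p}(x, y, z)` is the alternating sum of the `γ₂(x, [y, z])`. Both
sides vanish at `p`, so it suffices to compare differentials: the terms in `γ₁` cancel by the Jacobi
identity, and what is left is the Cartan formula `dFun_evalForm` for `d (ω(X, Y, Z))` with `X`, `Y`,
`Z` Hamiltonian. Comparing that formula with the invariance of `ω` under a fourth Hamiltonian vector
field shows that `ω_{3p}` is a cocycle (`sum_vfBracket_eq_zero`), so `ℝ[1] ⊕ g` with trinary bracket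
`-ω_{3p}` is a Lie 2-algebra.

On words `x a` and `x y z`, the equation `d η = ω_{3p}` reads `η([x, a]) = 0` and
`-(η([x, y], z) - η([x, z], y) + η([y, z], x)) - η([x, y, z]') = ω_{3p}(x, y, z)`, where
`[x, y, z]'` is the trinary bracket. These are the equations of an `L∞`-morphism for the map induced
by `η` (`inducedMap_isLInftyMorphism`), and `L∞`-morphisms compose (`IsLInftyMorphism.comp`).
-/

noncomputable section

set_option linter.unusedSectionVars false

namespace MomentMap

/-! ### Composition of morphisms, and extensions by cocycles -/

section Algebra
variable {V W V' W' V'' W'' : Type*} [AddCommGroup V] [Module ℝ V]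
    [AddCommGroup W] [Module ℝ W] [AddCommGroup V'] [Module ℝ V'] [AddCommGroup W']
    [Module ℝ W'] [AddCommGroup V''] [Module ℝ V''] [AddCommGroup W''] [Module ℝ W'']

theorem alternating_two_swap (f : V [⋀^Fin 2]→ₗ[ℝ] W) (x y : V) : f ![y, x] = -f ![x, y] := by
  have := f.map_swap ![x, y] (show (0 : Fin 2) ≠ 1 by decide)
  have e : ![x, y] ∘ Equiv.swap (0 : Fin 2) 1 = ![y, x] := by
    funext i; fin_cases i <;> rfl
  rwa [e] at this

theorem alternating_two_add_right (f : V [⋀^Fin 2]→ₗ[ℝ] W) (x y z : V) :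
    f ![x, y + z] = f ![x, y] + f ![x, z] := by
  have := f.map_update_add ![x, y] 1 y z
  have e : ∀ w, Function.update ![x, y] 1 w = ![x, w] := fun w => by
    funext i; fin_cases i <;> rfl
  simpa only [e] using this

theorem map_vec_two {S T : Type*} (F : S → T) (x y : S) :
    (fun i => F (![x, y] i)) = ![F x, F y] := by
  funext i; fin_cases i <;> rfl

theorem LInftyMap.comp_f₂ (G : LInftyMap V' W' V'' W'') (F : LInftyMap V W V' W') (x y : V) :
    (G.comp F).f₂ ![x, y] = G.f₁ (F.f₂ ![x, y]) + G.f₂ ![F.f₀ x, F.f₀ y] := by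
  rw [← map_vec_two]; rfl

theorem IsLInftyMorphism.comp {A : Lie2Brackets V W} {B : Lie2Brackets V' W'}
    {C : Lie2Brackets V'' W''} {G : LInftyMap V' W' V'' W''} {F : LInftyMap V W V' W'}
    (hG : IsLInftyMorphism B C G) (hF : IsLInftyMorphism A B F) :
    IsLInftyMorphism A C (G.comp F) where
  map_δ a := (hG.map_δ _).trans (congrArg G.f₀ (hF.map_δ a))
  map_br x y := by
    have h1 := congrArg G.f₀ (hF.map_br x y)
    rw [map_sub] at h1
    rw [LInftyMap.comp_f₂, map_add, hG.map_δ, hG.map_br, h1]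
    change _ = G.f₀ (F.f₀ _) - C.br (G.f₀ (F.f₀ x)) (G.f₀ (F.f₀ y))
    abel
  map_act a x := by
    have h1 := congrArg G.f₁ (hF.map_act a x)
    have h2 := hG.map_act (F.f₁ a) (F.f₀ x)
    rw [map_add, map_neg] at h1
    rw [LInftyMap.comp_f₂, h1, ← hF.map_δ, h2]
    change _ = -G.f₁ (F.f₁ _) + C.act (G.f₀ (F.f₀ x)) (G.f₁ (F.f₁ a))
    abel
  map_tri x y z := by
    have h1 := congrArg G.f₁ (hF.map_tri x y z)
    have h2 := hG.map_tri (F.f₀ x) (F.f₀ y) (F.f₀ z)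
    -- `F.f₀` preserves the bracket up to `δ (F.f₂ (u, w))`, on which `hG.map_act` evaluates `G.f₂`.
    have h3 : ∀ t u w, G.f₂ ![F.f₀ t, F.f₀ (A.br u w)] =
        G.f₂ ![F.f₀ t, B.br (F.f₀ u) (F.f₀ w)] + G.f₁ (B.act (F.f₀ t) (F.f₂ ![u, w])) -
          C.act (G.f₀ (F.f₀ t)) (G.f₁ (F.f₂ ![u, w])) := by
      intro t u w
      have e : F.f₀ (A.br u w) = B.br (F.f₀ u) (F.f₀ w) + B.δ (F.f₂ ![u, w]) := by
        rw [hF.map_br]; abel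
      rw [e, alternating_two_add_right,
        alternating_two_swap G.f₂ (B.δ (F.f₂ ![u, w])) (F.f₀ t), hG.map_act]
      abel
    simp only [map_sub, map_add] at h1
    have e4 : ∀ a, (G.comp F).f₁ a = G.f₁ (F.f₁ a) := fun _ => rfl
    have e5 : ∀ a, (G.comp F).f₀ a = G.f₀ (F.f₀ a) := fun _ => rfl
    simp only [LInftyMap.comp_f₂, e4, e5, h3, map_add]
    rw [sub_eq_iff_eq_add] at h1 h2 ⊢
    rw [h1, h2]
    abel

variable {g : Type*} [LieRing g] [LieAlgebra ℝ g]

/-- The Lie algebra cocycle condition on `c` is all that remains of the higher Jacobi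
identities of `ℝ[1] ⊕_c g`. -/
theorem lie2Ext_isLie2Algebra {c : g [⋀^Fin 3]→ₗ[ℝ] ℝ}
    (hc : ∀ x y z u, c ![⁅x, y⁆, z, u] + c ![y, ⁅x, z⁆, u] + c ![y, z, ⁅x, u⁆] -
        c ![x, ⁅y, z⁆, u] - c ![x, z, ⁅y, u⁆] + c ![x, y, ⁅z, u⁆] = 0) :
    (lie2Ext c).IsLie2Algebra where
  δ_act x a := by simp [lie2Ext]
  act_δ a b := by simp [lie2Ext]
  jacobi x y z := by
    change (0 : g) + ⁅⁅x, y⁆, z⁆ + ⁅⁅y, z⁆, x⁆ + ⁅⁅z, x⁆, y⁆ = 0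
    rw [zero_add, ← lie_skew ⁅x, y⁆ z, ← lie_skew ⁅y, z⁆ x, ← lie_skew ⁅z, x⁆ y,
      ← neg_eq_zero, ← lie_jacobi x y z]
    abel
  jacobi_act x y a := by
    have : c ![0, x, y] = 0 := c.map_coord_zero 0 rfl
    simpa [lie2Ext] using this
  cocycle x y z u := by
    rw [show (lie2Ext c).act = 0 from rfl]
    simpa [lie2Ext] using (hc x y z u).symm

end Algebra

/-! ### The Chevalley-Eilenberg differential in degree two -/

section CE
variable {g h : Type*} [AddCommGroup g] [Module ℝ g] [AddCommGroup h] [Module ℝ h]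

/-- A cochain in `CE` vanishes on a word with first letter `0 ∈ h`. The letter
`0 ∈ g` is a different one, since letters form the disjoint union `h ⊕ g`. -/
theorem CE.apply_cons_inl_zero {n k : ℕ} (ξ : CE g h n) (w : Fin k → h ⊕ g) :
    ξ.1 k (Fin.cons (Sum.inl 0) w) = 0 := by
  have := ((ξ.2 k (Fin.cons (Sum.inl 0) w)).1 0).1.map_zero
  rwa [Fin.update_cons_zero] at this

theorem CE.apply_cons_inr_zero {n k : ℕ} (ξ : CE g h n) (w : Fin k → h ⊕ g) :
    ξ.1 k (Fin.cons (Sum.inr 0) w) = 0 := by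
  have := ((ξ.2 k (Fin.cons (Sum.inr 0) w)).1 0).2.map_zero
  rwa [Fin.update_cons_zero] at this

theorem composeOp_l₁_eq_zero {L : Lie2Brackets g h} (hL : L.δ = 0) {n k : ℕ} (ξ : CE g h n)
    (w : Fin (k + 1) → h ⊕ g) : composeOp 1 k L.l₁ (ξ.1 k) w = 0 := by
  refine Finset.sum_eq_zero fun σ _ => mul_eq_zero_of_right _ ?_
  unfold Lie2Brackets.l₁
  split
  · rw [hL, LinearMap.zero_apply, neg_zero, CE.apply_cons_inr_zero]
  · rw [CE.apply_cons_inl_zero]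

theorem unshuffles_two_zero : unshuffles 2 0 = {1} := by decide

theorem unshuffles_three_zero : unshuffles 3 0 = {1} := by decide

theorem unshuffles_two_one :
    unshuffles 2 1 = {1, Equiv.swap 1 2, Equiv.swap 0 1 * Equiv.swap 1 2} := by
  decide

theorem koszulSign_one {n : ℕ} (w : Fin n → h ⊕ g) : koszulSign w 1 = 1 := by
  refine Finset.prod_eq_one fun i _ => Finset.prod_eq_one fun j _ => if_neg ?_
  rintro ⟨hij, hji, -⟩
  exact lt_asymm hij hji

theorem hPart_apply (η : CE g h 2) (w : Fin 0 → h ⊕ g) (a : h) :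
    η.1 0 (Fin.cons (Sum.inl a) w) = hPart η a :=
  congrArg (η.1 0) (funext fun i => by fin_cases i; rfl)

theorem ggPart_apply (η : CE g h 2) (x y : g) (w : Fin 1 → h ⊕ g) (hw : w 0 = Sum.inr y) :
    η.1 1 (Fin.cons (Sum.inr x) w) = ggPart η ![x, y] :=
  congrArg (η.1 1) (funext fun i => by
    fin_cases i
    · rfl
    · exact hw)

/-- On a word `x a` only the summand `-d₂` contributes to `d η`. -/
theorem dCE_apply_inr_inl {L : Lie2Brackets g h} (hL : L.δ = 0) (η : CE g h 2) (x : g) (a : h) :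
    L.dCE η.1 1 ![Sum.inr x, Sum.inl a] = -hPart η (L.act x a) := by
  change composeOp 1 1 L.l₁ (η.1 1) _ - composeOp 2 0 L.l₂ (η.1 0) _ = _
  rw [composeOp_l₁_eq_zero hL, zero_sub, composeOp, unshuffles_two_zero, Finset.sum_singleton,
    koszulSign_one, one_mul]
  exact congrArg Neg.neg (hPart_apply η _ _)

/-- On a word `x y z` the summand `-d₂` contributes minus the sum of `η` over the three pairwise
brackets, and `d₃` contributes `η(l₃(x, y, z))`, where `l₃` is minus the trinary bracket. -/
theorem dCE_apply_inr_inr_inr {L : Lie2Brackets g h} (hL : L.δ = 0) (η : CE g h 2) (x y z : g) :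
    L.dCE η.1 2 ![Sum.inr x, Sum.inr y, Sum.inr z] =
      -(ggPart η ![L.br x y, z] - ggPart η ![L.br x z, y] + ggPart η ![L.br y z, x]) -
        hPart η (L.tri ![x, y, z]) := by
  change composeOp 1 2 L.l₁ (η.1 2) _ - composeOp 2 1 L.l₂ (η.1 1) _ +
    composeOp 3 0 L.l₃ (η.1 0) _ = _
  set w : Fin 3 → h ⊕ g := ![Sum.inr x, Sum.inr y, Sum.inr z] with hw
  have s1 : koszulSign w (Equiv.swap 1 2) = -1 := by
    simp [koszulSign, Fin.prod_univ_three, hw, letterDeg, Equiv.swap_apply_def]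
  have s2 : koszulSign w (Equiv.swap 0 1 * Equiv.swap 1 2) = 1 := by
    simp [koszulSign, Fin.prod_univ_three, hw, letterDeg, Equiv.swap_apply_def]
  have h2 : composeOp 2 1 L.l₂ (η.1 1) w =
      ggPart η ![L.br x y, z] - ggPart η ![L.br x z, y] + ggPart η ![L.br y z, x] := by
    rw [composeOp, unshuffles_two_one, Finset.sum_insert (by decide),
      Finset.sum_insert (by decide), Finset.sum_singleton, koszulSign_one]
    -- The three unshuffles single out the pairs `(x, y)`, `(x, z)` and `(y, z)`.
    change 1 * η.1 1 (Fin.cons (Sum.inr (L.br x y)) _) +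
      (koszulSign w (Equiv.swap 1 2) * η.1 1 (Fin.cons (Sum.inr (L.br x z)) _) +
        koszulSign w (Equiv.swap 0 1 * Equiv.swap 1 2) *
          η.1 1 (Fin.cons (Sum.inr (L.br y z)) _)) = _
    rw [s1, s2, ggPart_apply η _ z _ rfl, ggPart_apply η _ y _ rfl, ggPart_apply η _ x _ rfl]
    ring
  have h3 : composeOp 3 0 L.l₃ (η.1 0) w = -hPart η (L.tri ![x, y, z]) := by
    rw [composeOp, unshuffles_three_zero, Finset.sum_singleton, koszulSign_one, one_mul,
      ← map_neg]
    exact hPart_apply η _ _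
  rw [composeOp_l₁_eq_zero hL, h2, h3]
  ring

/-- The equation `d η = c` on words `x a` and `x y z` is the compatibility of the induced map with
the action and with the trinary brackets, respectively. -/
theorem inducedMap_isLInftyMorphism {g : Type*} [LieRing g] [LieAlgebra ℝ g]
    {L : Lie2Brackets g h} (hL : L.δ = 0) (hbr : ∀ x y, L.br x y = ⁅x, y⁆)
    (c : g [⋀^Fin 3]→ₗ[ℝ] ℝ) (η : CE g h 2) (hη : L.dCE η.1 = threeCochain h c) :
    IsLInftyMorphism L (lie2Ext (-c)) (inducedMap η) where
  map_δ a := by simp [hL, lie2Ext]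
  map_br x y := by
    rw [hbr]
    exact (sub_self (⁅x, y⁆ : g)).symm
  map_act a x := by
    have h1 : (inducedMap η).f₁ (L.act x a) = 0 := by
      have h2 := congrFun (congrFun hη 1) ![Sum.inr x, Sum.inl a]
      rw [dCE_apply_inr_inl hL] at h2
      exact neg_eq_zero.1 h2
    rw [h1, hL]
    have h0 : (inducedMap η).f₂ ![0, x] = 0 := (inducedMap η).f₂.map_coord_zero 0 rfl
    simp [lie2Ext, h0]
  map_tri x y z := by
    have h1 := congrFun (congrFun hη 2) ![Sum.inr x, Sum.inr y, Sum.inr z]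
    rw [dCE_apply_inr_inr_inr hL] at h1
    change _ = c ![x, y, z] at h1
    change hPart η (L.tri ![x, y, z]) - -c ![x, y, z] = ggPart η ![x, L.br y z] -
      ggPart η ![y, L.br x z] + ggPart η ![z, L.br x y] + 0 - 0 + 0
    rw [alternating_two_swap _ (L.br y z) x, alternating_two_swap _ (L.br x z) y,
      alternating_two_swap _ (L.br x y) z]
    linarith

end CE

/-! ### Cartan calculus on a normed space -/

section Local
variable {E : Type*} [NormedAddCommGroup E] [NormedSpace ℝ E]

theorem apply_sub_zero (a : E [⋀^Fin 3]→L[ℝ] ℝ) (p q r t : E) :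
    a ![q - r, p, t] = a ![q, p, t] - a ![r, p, t] := by
  have e : ∀ s, Function.update ![q, p, t] 0 s = ![s, p, t] := fun s => by
    funext i; fin_cases i <;> rfl
  simpa only [e] using a.map_update_sub ![q, p, t] 0 q r

theorem apply_sub_one (a : E [⋀^Fin 3]→L[ℝ] ℝ) (p q r t : E) :
    a ![p, q - r, t] = a ![p, q, t] - a ![p, r, t] := by
  rw [swap12, apply_sub_zero, swap12 a p q, swap12 a p r]; ring

theorem apply_sub_two (a : E [⋀^Fin 3]→L[ℝ] ℝ) (p q r t : E) :
    a ![p, t, q - r] = a ![p, t, q] - a ![p, t, r] := by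
  rw [swap23, apply_sub_one, swap23 a p q, swap23 a p r]; ring

/-- Cartan calculus: the differential of `w(X, Y, Z)`, if `w` and its contractions with `X`, `Y`, `Z`
are closed. -/
theorem fderiv_apply_three_of_closed {w : E → E [⋀^Fin 3]→L[ℝ] ℝ} {X Y Z : E → E} {x : E}
    (hw : DifferentiableAt ℝ w x) (hX : DifferentiableAt ℝ X x) (hY : DifferentiableAt ℝ Y x)
    (hZ : DifferentiableAt ℝ Z x)
    (h : extDeriv w x = 0) (h1 : extDeriv (fun y => (w y).curryLeft (X y)) x = 0)
    (h2 : extDeriv (fun y => (w y).curryLeft (Y y)) x = 0)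
    (h3 : extDeriv (fun y => (w y).curryLeft (Z y)) x = 0) (a : E) :
    fderiv ℝ (fun y => w y ![X y, Y y, Z y]) x a =
      -w x ![X x, VectorField.lieBracket ℝ Y Z x, a] +
        w x ![Y x, VectorField.lieBracket ℝ X Z x, a] -
        w x ![Z x, VectorField.lieBracket ℝ X Y x, a] := by
  have e0 := extDeriv_three w x (X x) (Y x) (Z x) a
  have e1 := extDeriv_curry_one hw hX (Y x) (Z x) a
  have e2 := extDeriv_curry_one hw hY (X x) (Z x) a
  have e3 := extDeriv_curry_one hw hZ (X x) (Y x) a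
  rw [h] at e0
  rw [h1] at e1
  rw [h2] at e2
  rw [h3] at e3
  simp only [ContinuousAlternatingMap.coe_zero, Pi.zero_apply] at e0 e1 e2 e3
  rw [fderiv_three hw hX hY hZ]
  simp only [VectorField.lieBracket_eq, apply_sub_one]
  -- The closedness equations determine the derivatives of `w` along `X`, `Y`, `Z` and `a`.
  set A := w x
  set B := fderiv ℝ w x
  grind [swap12, swap23]

/-- The bracket terms in the invariant formula for `d w (X, Y, Z, U)` cancel by themselves, if `w` and
its contractions with the four vector fields are closed: both
`U w(X, Y, Z) = -w(X, [Y, Z], U) + w(Y, [X, Z], U) - w(Z, [X, Y], U)` and, as `w` is invariant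
under `U`, `U w(X, Y, Z) = w([U, X], Y, Z) + w(X, [U, Y], Z) + w(X, Y, [U, Z])`. -/
theorem sum_lieBracket_eq_zero {w : E → E [⋀^Fin 3]→L[ℝ] ℝ} {X Y Z U : E → E} {x : E}
    (hw : DifferentiableAt ℝ w x) (hX : DifferentiableAt ℝ X x) (hY : DifferentiableAt ℝ Y x)
    (hZ : DifferentiableAt ℝ Z x) (hU : DifferentiableAt ℝ U x)
    (h : extDeriv w x = 0) (h1 : extDeriv (fun y => (w y).curryLeft (X y)) x = 0)
    (h2 : extDeriv (fun y => (w y).curryLeft (Y y)) x = 0)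
    (h3 : extDeriv (fun y => (w y).curryLeft (Z y)) x = 0)
    (h4 : extDeriv (fun y => (w y).curryLeft (U y)) x = 0) :
    w x ![VectorField.lieBracket ℝ X Y x, Z x, U x] +
      w x ![Y x, VectorField.lieBracket ℝ X Z x, U x] +
      w x ![Y x, Z x, VectorField.lieBracket ℝ X U x] -
      w x ![X x, VectorField.lieBracket ℝ Y Z x, U x] -
      w x ![X x, Z x, VectorField.lieBracket ℝ Y U x] +
      w x ![X x, Y x, VectorField.lieBracket ℝ Z U x] = 0 := by
  have e0 := extDeriv_three w x (X x) (Y x) (Z x) (U x)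
  have e1 := extDeriv_curry_one hw hX (Y x) (Z x) (U x)
  have e2 := extDeriv_curry_one hw hY (X x) (Z x) (U x)
  have e3 := extDeriv_curry_one hw hZ (X x) (Y x) (U x)
  have e4 := extDeriv_curry_one hw hU (X x) (Y x) (Z x)
  rw [h] at e0
  rw [h1] at e1
  rw [h2] at e2
  rw [h3] at e3
  rw [h4] at e4
  simp only [ContinuousAlternatingMap.coe_zero, Pi.zero_apply] at e0 e1 e2 e3 e4
  simp only [VectorField.lieBracket_eq, apply_sub_zero, apply_sub_one, apply_sub_two]
  set A := w x
  set B := fderiv ℝ w x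
  grind [swap12, swap23]
end Local

/-! ### Functions with vanishing differential -/

section Forms
variable {E : Type*} [NormedAddCommGroup E] [NormedSpace ℝ E]
  {M : Type*} [TopologicalSpace M] [ChartedSpace E M] [IsManifold 𝓘(ℝ, E) ∞ M] [CompleteSpace E]

/-- In a chart, `d f` is the Fréchet derivative of `f`, read as an alternating 1-form. -/
theorem inChart_dFun (f : SmoothFun E M) (x₀ : M) {u : E}
    (hu : u ∈ (extChartAt 𝓘(ℝ, E) x₀).target) :
    inChart (dFun f).1 x₀ u = ContinuousAlternatingMap.ofSubsingleton ℝ E ℝ (0 : Fin 1)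
      (fderiv ℝ (fun u => f ((extChartAt 𝓘(ℝ, E) x₀).symm u)) u) := by
  rw [← extDeriv_constOfIsEmpty]
  exact inChart_dField (zeroForm f).2 x₀ hu

theorem dFun_apply (f : SmoothFun E M) (x : M) (m : Fin 1 → E) :
    ((dFun f).1 x : E [⋀^Fin 1]→L[ℝ] ℝ) m =
      fderiv ℝ (fun u => f ((extChartAt 𝓘(ℝ, E) x).symm u)) (extChartAt 𝓘(ℝ, E) x x) (m 0) := by
  rw [← inChart_self (dFun f).1 x, inChart_dFun f x (mem_extChartAt_target x)]
  rfl

theorem differentiableAt_comp_symm (f : SmoothFun E M) (x₀ : M) {u : E}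
    (hu : u ∈ (extChartAt 𝓘(ℝ, E) x₀).target) :
    DifferentiableAt ℝ (fun u => f ((extChartAt 𝓘(ℝ, E) x₀).symm u)) u := by
  have h : ContDiffAt ℝ ∞ (fun u => f ((extChartAt 𝓘(ℝ, E) x₀).symm u)) u := by
    refine contMDiffAt_iff_contDiffAt.1 ?_
    exact f.contMDiff.contMDiffAt.comp u
      ((contMDiffOn_extChartAt_symm x₀).contMDiffAt (target_nhds x₀ hu))
  exact h.differentiableAt (by simp)

theorem isLocallyConstant_of_dFun_eq_zero {f : SmoothFun E M} (hf : dFun f = 0) :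
    IsLocallyConstant f := by
  rw [IsLocallyConstant.iff_eventually_eq]
  intro x
  obtain ⟨r, hr, hball⟩ := Metric.isOpen_iff.1 (isOpen_extChartAt_target (I := 𝓘(ℝ, E)) x) _
    (mem_extChartAt_target (I := 𝓘(ℝ, E)) x)
  have hd : ∀ u ∈ Metric.ball (extChartAt 𝓘(ℝ, E) x x) r,
      fderiv ℝ (fun u => f ((extChartAt 𝓘(ℝ, E) x).symm u)) u = 0 := by
    intro u hu
    have h := inChart_dFun f x (hball hu)
    rw [hf] at h
    ext a
    exact (congrArg (fun α : E [⋀^Fin 1]→L[ℝ] ℝ => α fun _ => a) h).symm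
  filter_upwards [extChartAt_source_mem_nhds (I := 𝓘(ℝ, E)) x,
    (continuousAt_extChartAt (I := 𝓘(ℝ, E)) x).preimage_mem_nhds (Metric.ball_mem_nhds _ hr)]
    with y hy hy'
  have h := Metric.isOpen_ball.is_const_of_fderiv_eq_zero
    (convex_ball (extChartAt 𝓘(ℝ, E) x x) r).isPreconnected
    (fun u hu => (differentiableAt_comp_symm f x (hball hu)).differentiableWithinAt) hd hy'
    (Metric.mem_ball_self hr)
  rwa [extChartAt_to_inv, (extChartAt 𝓘(ℝ, E) x).left_inv hy] at h

theorem eq_of_dFun_eq [ConnectedSpace M] {f₁ f₂ : SmoothFun E M} (p : M)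
    (h : dFun f₁ = dFun f₂) (hp : f₁ p = f₂ p) : f₁ = f₂ := by
  have h0 : dFun (f₁ - f₂) = 0 := by rw [map_sub, h, sub_self]
  ext q
  have hq : (f₁ - f₂) q = (f₁ - f₂) p :=
    (isLocallyConstant_of_dFun_eq_zero h0).apply_eq_of_isPreconnected isPreconnected_univ
      (Set.mem_univ q) (Set.mem_univ p)
  change f₁ q - f₂ q = f₁ p - f₂ p at hq
  linarith

/-! ### Cartan calculus on a manifold -/

theorem extDeriv_inChart_eq_zero {k : ℕ} {β : DForm E M k} (hβ : dForm k β = 0) (x : M) :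
    extDeriv (inChart β.1 x) (extChartAt 𝓘(ℝ, E) x x) = 0 := by
  rw [← dField_apply β.2]
  exact congrArg (fun γ : DForm E M _ => γ.1 x) hβ

theorem extDeriv_curryLeft_inChart_eq_zero {k : ℕ} {α : DForm E M (k + 1)} {X : VField E M}
    (hX : dForm k (ι X α) = 0) (x : M) :
    extDeriv (fun u => (inChart α.1 x u).curryLeft (vfInChart X x u))
      (extChartAt 𝓘(ℝ, E) x x) = 0 := by
  have e1 : inChart (ι X α).1 x =ᶠ[𝓝 (extChartAt 𝓘(ℝ, E) x x)]
      fun u => (inChart α.1 x u).curryLeft (vfInChart X x u) :=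
    Filter.Eventually.mono (target_nhds x (mem_extChartAt_target x)) fun u hu =>
      inChart_contract X α.1 x hu
  rw [← e1.extDeriv_eq]
  exact extDeriv_inChart_eq_zero hX x

theorem differentiableAt_vfInChart (X : VField E M) (x : M) :
    DifferentiableAt ℝ (vfInChart X x) (extChartAt 𝓘(ℝ, E) x x) :=
  (contDiffAt_vfInChart X x (mem_extChartAt_target x)).differentiableAt (by simp)

theorem vfInChart_self (X : VField E M) (x : M) :
    vfInChart X x (extChartAt 𝓘(ℝ, E) x x) = X x := by
  have h := symm_vfInChart X x (mem_extChartAt_target x)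
  have h2 := mfderivWithin_range_extChartAt_symm (I := 𝓘(ℝ, E)) (x := x)
  simp only [modelWithCornersSelf_coe, Set.range_id, mfderivWithin_univ] at h2
  exact ((congrArg (fun L : E →L[ℝ] E => L (vfInChart X x (extChartAt 𝓘(ℝ, E) x x))) h2).symm.trans
    h).trans (congrArg (fun y => (X y : E)) (extChartAt_to_inv x))

theorem evalForm_comp_symm (α : DForm E M 3) (X Y Z : VField E M) (x : M) {u : E}
    (hu : u ∈ (extChartAt 𝓘(ℝ, E) x).target) :
    evalForm α ![X, Y, Z] ((extChartAt 𝓘(ℝ, E) x).symm u) =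
      inChart α.1 x u ![vfInChart X x u, vfInChart Y x u, vfInChart Z x u] := by
  refine formField_congr α.1 rfl (funext fun i => ?_)
  fin_cases i <;> exact (symm_vfInChart _ x hu).symm

/-- The global form of `fderiv_apply_three_of_closed`. -/
theorem dFun_evalForm {α : DForm E M 3} {X Y Z : VField E M} (h : dForm 3 α = 0)
    (hX : dForm 2 (ι X α) = 0) (hY : dForm 2 (ι Y α) = 0) (hZ : dForm 2 (ι Z α) = 0) :
    dFun (evalForm α ![X, Y, Z]) = -ι (vfBracket Y Z) (ι X α) + ι (vfBracket X Z) (ι Y α) -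
      ι (vfBracket X Y) (ι Z α) := by
  refine Subtype.ext (funext fun x => ?_)
  ext m
  obtain ⟨a, rfl⟩ : ∃ a, m = ![a] := ⟨m 0, by funext i; fin_cases i; rfl⟩
  have ht := mem_extChartAt_target (I := 𝓘(ℝ, E)) x
  refine (dFun_apply _ x _).trans ?_
  have e : (fun u => evalForm α ![X, Y, Z] ((extChartAt 𝓘(ℝ, E) x).symm u)) =ᶠ[
      𝓝 (extChartAt 𝓘(ℝ, E) x x)] fun u =>
      inChart α.1 x u ![vfInChart X x u, vfInChart Y x u, vfInChart Z x u] :=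
    Filter.Eventually.mono (target_nhds x ht) fun u hu => evalForm_comp_symm α X Y Z x hu
  rw [e.fderiv_eq, fderiv_apply_three_of_closed (SmoothForm.differentiableAt α.2 x ht)
    (differentiableAt_vfInChart X x) (differentiableAt_vfInChart Y x)
    (differentiableAt_vfInChart Z x) (extDeriv_inChart_eq_zero h x)
    (extDeriv_curryLeft_inChart_eq_zero hX x) (extDeriv_curryLeft_inChart_eq_zero hY x)
    (extDeriv_curryLeft_inChart_eq_zero hZ x), inChart_self]
  rw [← mlieBracket_inChart, ← mlieBracket_inChart, ← mlieBracket_inChart, vfInChart_self,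
    vfInChart_self, vfInChart_self]
  rfl

/-- The global form of `sum_lieBracket_eq_zero`. -/
theorem sum_vfBracket_eq_zero {α : DForm E M 3} {X Y Z U : VField E M} (h : dForm 3 α = 0)
    (hX : dForm 2 (ι X α) = 0) (hY : dForm 2 (ι Y α) = 0) (hZ : dForm 2 (ι Z α) = 0)
    (hU : dForm 2 (ι U α) = 0) :
    evalForm α ![vfBracket X Y, Z, U] + evalForm α ![Y, vfBracket X Z, U] +
      evalForm α ![Y, Z, vfBracket X U] - evalForm α ![X, vfBracket Y Z, U] -
      evalForm α ![X, Z, vfBracket Y U] + evalForm α ![X, Y, vfBracket Z U] = 0 := by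
  ext x
  have ht := mem_extChartAt_target (I := 𝓘(ℝ, E)) x
  have key := sum_lieBracket_eq_zero (SmoothForm.differentiableAt α.2 x ht)
    (differentiableAt_vfInChart X x) (differentiableAt_vfInChart Y x)
    (differentiableAt_vfInChart Z x) (differentiableAt_vfInChart U x)
    (extDeriv_inChart_eq_zero h x)
    (extDeriv_curryLeft_inChart_eq_zero hX x) (extDeriv_curryLeft_inChart_eq_zero hY x)
    (extDeriv_curryLeft_inChart_eq_zero hZ x) (extDeriv_curryLeft_inChart_eq_zero hU x)
  simp only [← mlieBracket_inChart, vfInChart_self, inChart_self] at key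
  have e : ∀ A B C : VField E M, evalForm α ![A, B, C] x =
      (α.1 x : E [⋀^Fin 3]→L[ℝ] ℝ) ![A x, B x, C x] := fun A B C =>
    formField_congr α.1 rfl (funext fun i => by fin_cases i <;> rfl)
  change evalForm α _ x + evalForm α _ x + evalForm α _ x - evalForm α _ x - evalForm α _ x +
    evalForm α _ x = 0
  simp only [e]
  exact key

/-! ### Primitives of closed 1-forms -/

variable (E M) in
/-- Real numbers as constant functions on `M`. -/
def constFun : ℝ →ₗ[ℝ] SmoothFun E M := Algebra.linearMap ℝ (SmoothFun E M)

theorem constFun_apply (r : ℝ) (q : M) : constFun E M r q = r := rfl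

theorem dFun_constFun (r : ℝ) : dFun (constFun E M r) = 0 := by
  refine Subtype.ext (funext fun x => ?_)
  ext m
  refine (dFun_apply _ x m).trans ?_
  simp only [constFun_apply, fderiv_const_apply]
  rfl

/-- If `H¹(M) = 0`, every closed 1-form has a primitive that vanishes at `p`. -/
theorem exists_dFun_eq (hH : Subsingleton (DeRham1 E M)) (p : M)
    (α : LinearMap.ker (dForm (E := E) (M := M) 1)) :
    ∃ f : SmoothFun E M, dFun f = α.1 ∧ f p = 0 := by
  have h : (Submodule.Quotient.mk α : DeRham1 E M) = 0 := Subsingleton.elim _ _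
  obtain ⟨f, hf⟩ : ∃ f : SmoothFun E M, dFun f = α.1 := (Submodule.Quotient.mk_eq_zero _).1 h
  -- Subtracting a constant normalizes the primitive at `p`.
  refine ⟨f - constFun E M (f p), ?_, sub_self (f p)⟩
  rw [map_sub, dFun_constFun, sub_zero, hf]

/-- The primitive of a closed 1-form that vanishes at `p`, in case `H¹(M) = 0`. -/
def primitiveAt [ConnectedSpace M] (hH : Subsingleton (DeRham1 E M)) (p : M) :
    LinearMap.ker (dForm (E := E) (M := M) 1) →ₗ[ℝ] SmoothFun E M where
  toFun α := (exists_dFun_eq hH p α).choose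
  map_add' α β := by
    have hα := (exists_dFun_eq hH p α).choose_spec
    have hβ := (exists_dFun_eq hH p β).choose_spec
    have h := (exists_dFun_eq hH p (α + β)).choose_spec
    refine eq_of_dFun_eq p ?_ (h.2.trans ?_)
    · rw [map_add, hα.1, hβ.1, h.1]; rfl
    · exact (by rw [hα.2, hβ.2, add_zero] : _ + _ = (0 : ℝ)).symm
  map_smul' r α := by
    have hα := (exists_dFun_eq hH p α).choose_spec
    have h := (exists_dFun_eq hH p (r • α)).choose_spec
    refine eq_of_dFun_eq p ?_ (h.2.trans ?_)
    · rw [map_smul, hα.1, h.1]; rfl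
    · exact (by rw [hα.2, mul_zero] : r * _ = (0 : ℝ)).symm

theorem dFun_primitiveAt [ConnectedSpace M] (hH : Subsingleton (DeRham1 E M)) (p : M)
    (α : LinearMap.ker (dForm (E := E) (M := M) 1)) : dFun (primitiveAt hH p α) = α.1 :=
  (exists_dFun_eq hH p α).choose_spec.1

theorem primitiveAt_self [ConnectedSpace M] (hH : Subsingleton (DeRham1 E M)) (p : M)
    (α : LinearMap.ker (dForm (E := E) (M := M) 1)) : primitiveAt hH p α p = 0 :=
  (exists_dFun_eq hH p α).choose_spec.2

/-! ### The moment map normalized at a point -/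

namespace TwoPlectic
variable (P : TwoPlectic E M) {g : Type*} [LieRing g] [LieAlgebra ℝ g]
  {v : g →ₗ[ℝ] VField E M} {γ₁ : g →ₗ[ℝ] P.Ham}

/-- The 1-form `γ₁([x, y]) - ω(v_x, v_y, ·)`: the failure of `γ₁` to preserve brackets. -/
def bracketDefectForm (v : g →ₗ[ℝ] VField E M) (γ₁ : g →ₗ[ℝ] P.Ham) :
    g [⋀^Fin 2]→ₗ[ℝ] DForm E M 1 where
  toFun m := (γ₁ ⁅m 0, m 1⁆).1 - ι (v (m 1)) (ι (v (m 0)) P.form)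
  map_update_add' m i x y := by
    have h01 : (1 : Fin 2) ≠ 0 := one_ne_zero
    fin_cases i <;> simp [h01, Function.update_of_ne] <;> abel
  map_update_smul' m i r x := by
    have h01 : (1 : Fin 2) ≠ 0 := one_ne_zero
    fin_cases i <;> simp [h01, Function.update_of_ne, smul_sub]
  map_eq_zero_of_eq' m i j hm hij := by
    have h01 : m 0 = m 1 := by
      fin_cases i <;> fin_cases j <;> first | exact absurd rfl hij | exact hm | exact hm.symm
    have h2 : ι (v (m 1)) (ι (v (m 1)) P.form) = 0 := by
      refine Subtype.ext (funext fun x => ?_)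
      ext m
      exact (P.form.1 x).map_eq_zero_of_eq _ (i := 0) (j := 1) rfl (by decide)
    rw [h01, lie_self, map_zero, h2]
    exact sub_zero 0

/-- `γ₁([x, y])` and `ω(v_x, v_y, ·)` have the same Hamiltonian vector field `v_{[x, y]}`. -/
theorem dForm_bracketDefectForm (hv : ∀ x y, v ⁅x, y⁆ = vfBracket (v x) (v y))
    (hγ₁ : ∀ x, P.IsHamVF (γ₁ x).1 (v x)) (m : Fin 2 → g) :
    dForm 1 (P.bracketDefectForm v γ₁ m) = 0 := by
  change dForm 1 ((γ₁ ⁅m 0, m 1⁆).1 - ι (v (m 1)) (ι (v (m 0)) P.form)) = 0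
  rw [map_sub, hγ₁, dForm_ι_ι P.closed (hγ₁ _).closed (hγ₁ _).closed, hv, sub_self]

/-- The map `γ` with `γ₁` on `g`, constant functions on `ℝ`, and `γ₂(x, y)` the primitive of
`γ₁([x, y]) - ω(v_x, v_y, ·)` that vanishes at `p`. -/
def basedMap (hv : ∀ x y, v ⁅x, y⁆ = vfBracket (v x) (v y))
    (hγ₁ : ∀ x, P.IsHamVF (γ₁ x).1 (v x)) [ConnectedSpace M] (hH : Subsingleton (DeRham1 E M))
    (p : M) : LInftyMap g ℝ P.Ham (SmoothFun E M) where
  f₀ := γ₁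
  f₁ := constFun E M
  f₂ := (primitiveAt hH p).compAlternatingMap
    ((P.bracketDefectForm v γ₁).codRestrict (LinearMap.ker (dForm 1))
      (P.dForm_bracketDefectForm hv hγ₁))

section
variable (hv : ∀ x y, v ⁅x, y⁆ = vfBracket (v x) (v y))
    (hγ₁ : ∀ x, P.IsHamVF (γ₁ x).1 (v x)) [ConnectedSpace M] (hH : Subsingleton (DeRham1 E M))
    (p : M)

theorem dFun_basedMap_f₂ (x y : g) : dFun ((P.basedMap hv hγ₁ hH p).f₂ ![x, y]) =
    (γ₁ ⁅x, y⁆).1 - ι (v y) (ι (v x) P.form) :=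
  dFun_primitiveAt hH p _

theorem basedMap_f₂_self (m : Fin 2 → g) : (P.basedMap hv hγ₁ hH p).f₂ m p = 0 :=
  primitiveAt_self hH p _

theorem threeForm_apply (x y z : g) :
    P.threeForm v p ![x, y, z] = evalForm P.form ![v x, v y, v z] p := by
  have e : (fun i => v (![x, y, z] i)) = ![v x, v y, v z] := by
    funext i; fin_cases i <;> rfl
  rw [← e]; rfl

/-- `ω_{3p}` is a Lie algebra cocycle, by `sum_vfBracket_eq_zero` at the point `p`. -/
theorem threeForm_isLie2Algebra (hv : ∀ x y, v ⁅x, y⁆ = vfBracket (v x) (v y))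
    (hγ₁ : ∀ x, P.IsHamVF (γ₁ x).1 (v x)) (p : M) : (lie2Ext (-P.threeForm v p)).IsLie2Algebra := by
  refine lie2Ext_isLie2Algebra fun x y z u => ?_
  have h := sum_vfBracket_eq_zero P.closed (hγ₁ x).closed (hγ₁ y).closed (hγ₁ z).closed
    (hγ₁ u).closed
  simp only [← hv] at h
  have hp := congrArg (fun f : SmoothFun E M => f p) h
  change evalForm P.form _ p + evalForm P.form _ p + evalForm P.form _ p -
    evalForm P.form _ p - evalForm P.form _ p + evalForm P.form _ p = 0 at hp
  simp only [AlternatingMap.neg_apply, threeForm_apply]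
  linarith

theorem isMomentMap_basedMap :
    P.IsMomentMap (lie2Ext (-P.threeForm v p)) v (P.basedMap hv hγ₁ hH p) := by
  have hham : ∀ x, P.hamVF (γ₁ x) = v x := fun x => (P.isHamVF_hamVF _).unique (hγ₁ x)
  have hbr : ∀ x y, (P.observables.br (γ₁ x) (γ₁ y)).1 = ι (v y) (ι (v x) P.form) := fun x y => by
    rw [← hham x, ← hham y]; rfl
  have htri : ∀ x y z, P.observables.tri ![γ₁ x, γ₁ y, γ₁ z] =
      -evalForm P.form ![v x, v y, v z] := fun x y z => by
    have e : (fun i => P.hamVF (![γ₁ x, γ₁ y, γ₁ z] i)) = ![v x, v y, v z] := by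
      funext i; fin_cases i <;> exact hham _
    rw [← e]; rfl
  refine ⟨⟨fun r => ?_, fun x y => ?_, fun r x => ?_, fun x y z => ?_⟩, hγ₁⟩
  · exact (Subtype.ext (dFun_constFun r)).trans (map_zero γ₁).symm
  · refine Subtype.ext ((P.dFun_basedMap_f₂ hv hγ₁ hH p x y).trans ?_)
    rw [← hbr]; rfl
  · have h0 : (P.basedMap hv hγ₁ hH p).f₂ ![0, x] = 0 :=
      (P.basedMap hv hγ₁ hH p).f₂.map_coord_zero 0 rfl
    simp [lie2Ext, observables, h0]
  · set γ := P.basedMap hv hγ₁ hH p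
    change constFun E M (-P.threeForm v p ![x, y, z]) - P.observables.tri ![γ₁ x, γ₁ y, γ₁ z] =
      γ.f₂ ![x, ⁅y, z⁆] - γ.f₂ ![y, ⁅x, z⁆] + γ.f₂ ![z, ⁅x, y⁆] + 0 - 0 + 0
    rw [htri, sub_neg_eq_add, add_zero, sub_zero, add_zero]
    -- Both sides are smooth functions with the same differential, and both vanish at `p`.
    refine eq_of_dFun_eq p ?_ ?_
    · have hj : γ₁ ⁅x, ⁅y, z⁆⁆ - γ₁ ⁅y, ⁅x, z⁆⁆ + γ₁ ⁅z, ⁅x, y⁆⁆ = 0 := by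
        rw [← map_sub, ← map_add, leibniz_lie x y z, add_sub_cancel_right, ← lie_skew,
          neg_add_cancel, map_zero]
      have hj' := congrArg Subtype.val hj
      change (γ₁ ⁅x, ⁅y, z⁆⁆).1 - (γ₁ ⁅y, ⁅x, z⁆⁆).1 + (γ₁ ⁅z, ⁅x, y⁆⁆).1 = 0 at hj'
      simp only [map_add, map_sub, dFun_constFun, γ, dFun_basedMap_f₂, hv,
        dFun_evalForm P.closed (hγ₁ x).closed (hγ₁ y).closed (hγ₁ z).closed] at hj' ⊢
      rw [zero_add, ← sub_eq_zero, ← neg_eq_zero, ← hj']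
      abel
    · change -P.threeForm v p ![x, y, z] + evalForm P.form ![v x, v y, v z] p =
        γ.f₂ _ p - γ.f₂ _ p + γ.f₂ _ p
      rw [threeForm_apply, basedMap_f₂_self, basedMap_f₂_self, basedMap_f₂_self]
      ring
end
end TwoPlectic

end Forms

end MomentMap

end

theorem mainTheorem2 {E : Type*} [NormedAddCommGroup E] [NormedSpace ℝ E]
    [FiniteDimensional ℝ E] [CompleteSpace E]
    {M : Type*} [TopologicalSpace M] [ChartedSpace E M] [IsManifold 𝓘(ℝ, E) ∞ M]
    [T2Space M] [SecondCountableTopology M] [ConnectedSpace M]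
    (P : TwoPlectic E M)
    {g h : Type*} [LieRing g] [LieAlgebra ℝ g] [AddCommGroup h] [Module ℝ h]
    (v : g →ₗ[ℝ] VField E M) (hv : ∀ x y, v ⁅x, y⁆ = vfBracket (v x) (v y))
    (L : Lie2Brackets g h) (hL : L.IsLie2Algebra) (hmin : L.δ = 0)
    (hbr : ∀ x y, L.br x y = ⁅x, y⁆)
    (p : M) (hH : Subsingleton (DeRham1 E M))
    (γ₁ : g →ₗ[ℝ] P.Ham) (hγ₁ : ∀ x, P.IsHamVF (γ₁ x).1 (v x)) :
    (lie2Ext (-P.threeForm v p)).IsLie2Algebra ∧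
    ∃ γ : LInftyMap g ℝ P.Ham (SmoothFun E M),
      γ.f₀ = γ₁ ∧
      (∀ (r : ℝ) (q : M), γ.f₁ r q = r) ∧
      (∀ (x y : g) (f : SmoothFun E M), f = γ.f₂ ![x, y] ↔
        dFun f = (γ₁ ⁅x, y⁆).1 - ι (v y) (ι (v x) P.form) ∧ f p = 0) ∧
      P.IsMomentMap (lie2Ext (-P.threeForm v p)) v γ ∧
      ∀ η : CE g h 2, L.dCE η.1 = threeCochain h (P.threeForm v p) →
        IsLInftyMorphism L (lie2Ext (-P.threeForm v p)) (inducedMap η) ∧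
        P.IsMomentMap L v (γ.comp (inducedMap η)) ∧
        (∀ x, (γ.comp (inducedMap η)).f₀ x = γ₁ x) ∧
        (∀ (a : h) (q : M), (γ.comp (inducedMap η)).f₁ a q = hPart η a) ∧
        (∀ (x y : g) (q : M), (γ.comp (inducedMap η)).f₂ ![x, y] q =
          ggPart η ![x, y] + γ.f₂ ![x, y] q) := by
  refine ⟨P.threeForm_isLie2Algebra hv hγ₁ p, P.basedMap hv hγ₁ hH p, rfl, fun _ _ => rfl,
    fun x y f => ⟨?_, fun h => ?_⟩, P.isMomentMap_basedMap hv hγ₁ hH p, fun η hη => ?_⟩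
  · rintro rfl
    exact ⟨P.dFun_basedMap_f₂ hv hγ₁ hH p x y, P.basedMap_f₂_self hv hγ₁ hH p _⟩
  · exact eq_of_dFun_eq p (h.1.trans (P.dFun_basedMap_f₂ hv hγ₁ hH p x y).symm)
      (h.2.trans (P.basedMap_f₂_self hv hγ₁ hH p _).symm)
  · have hf := inducedMap_isLInftyMorphism hmin hbr _ η hη
    refine ⟨hf, ⟨(P.isMomentMap_basedMap hv hγ₁ hH p).1.comp hf, hγ₁⟩, fun _ => rfl, fun _ _ => rfl,
      fun x y q => ?_⟩
    rw [LInftyMap.comp_f₂]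
    rfl
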